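/- Let $d\ge 2$. For $\varepsilon>0$ put $z_\varepsilon=1+i\varepsilon$ and let $\chi_\varepsilon$ be the indicator function of the tube $T_\varepsilon=\{x=(x_1,x')\in\mathbb R\times\mathbb R^{d-1}:\ |x_1|<\varepsilon^{-1},\ |x'|<\varepsilon^{-1/2}\}$. For $V\in L^\infty(\mathbb R^d;\mathbb C)$ let $H_V=-\Delta+V$ be the Schrödinger operator on $L^2(\mathbb R^d)$ with domain $H^2(\mathbb R^d)=\{u\in L^2:\Delta u\in L^2\}$. Write $\mathbb R_+=[0,\infty)$. There is a family of potentials $V_\varepsilon\in L^\infty(\mathbb R^d;\mathbb C)$, $\varepsilon>0$ (depending only on $d$ and $\varepsilon$), such that * for every $\varepsilon>0$, $V_\varepsilon=0$ almost everywhere outside $T_\varepsilon$, and $z_\varepsilon$ is an eigenvalue of $H_{V_\varepsilon}$; * there are constants $C,\varepsilon_0>0$ with $|V_\varepsilon|\le C\varepsilon\chi_\varepsilon$ almost everywhere for $0<\varepsilon<\varepsilon_0$; and such that for every real $q\ge (d+1)/2$ $$\liminf_{\varepsilon\to 0^+}\ \frac{\operatorname{dist}(z_\varepsilon,\mathbb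 R_+)^{\,q-\frac{d+1}{2}}\,|z_\varepsilon|^{\frac12}}{\|V_\varepsilon\|_q^q}>0 .$$ Consequently the bound $\operatorname{dist}(z,\mathbb R_+)^{q-\frac{d+1}{2}}|z|^{\frac12}\le C_{q,d}\|V\|_q^q$ is sharp, in the sense that the exponent of $\operatorname{dist}(z,\mathbb R_+)$ cannot be made smaller while preserving scale invariance: for every $q\ge (d+1)/2$ and every real $\alpha<q-\frac{d+1}{2}$ there is no constant $C$ such that $$\operatorname{dist}(z,\mathbb R_+)^{\alpha}\,|z|^{\,q-\frac d2-\alpha}\le C\,\|V\|_q^q$$ holds for all $V\in L^\infty(\mathbb R^d)\cap L^q(\mathbb R^d)$ and all eigenvalues $z\in\mathbb C\setminus\mathbb R_+$ of $H_V$. -/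

import Mathlib

open MeasureTheory Filter Topology
open scoped ENNReal NNReal SchwartzMap Laplacian

noncomputable section

/-- The complex Hilbert space `L²(ℝ^d)`. -/
abbrev L2Space (d : ℕ) : Type :=
  Lp (α := EuclideanSpace ℝ (Fin d)) ℂ 2 volume

/-- The space `L^∞(ℝ^d)` of complex-valued (essentially) bounded potentials. -/
abbrev BoundedPotential (d : ℕ) : Type :=
  Lp (α := EuclideanSpace ℝ (Fin d)) ℂ ∞ volume

/-- The embedding of `L²(ℝ^d)` into the tempered distributions, as a linear map. -/
def l2ToDistribution (d : ℕ) : L2Space d →ₗ[ℂ] 𝓢'(EuclideanSpace ℝ (Fin d), ℂ) :=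
  (Lp.toTemperedDistributionCLM (E := EuclideanSpace ℝ (Fin d)) ℂ volume 2).toLinearMap

theorem l2ToDistribution_injective (d : ℕ) : Function.Injective (l2ToDistribution d) :=
  LinearMap.ker_eq_bot.mp (Lp.ker_toTemperedDistributionCLM_eq_bot (p := 2))

/-- The distributional Laplacian of an `L²` function. -/
def distributionalLaplacian (d : ℕ) : L2Space d →ₗ[ℂ] 𝓢'(EuclideanSpace ℝ (Fin d), ℂ) where
  toFun u := Δ (l2ToDistribution d u)
  map_add' u v := by
    simp only [map_add, ← TemperedDistribution.laplacianCLM_apply]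
  map_smul' c u := by
    simp only [map_smul, ← TemperedDistribution.laplacianCLM_apply, RingHom.id_apply]

/-- The free Hamiltonian `H₀ = -Δ` on `L²(ℝ^d)`: its domain consists of all `u ∈ L²` whose
distributional Laplacian is in `L²` (this is the Sobolev space `H²`), and `H₀ u = -Δ u`. -/
def freeHamiltonian (d : ℕ) : L2Space d →ₗ.[ℂ] L2Space d where
  domain := (LinearMap.range (l2ToDistribution d)).comap (distributionalLaplacian d)
  toFun :=
    -((LinearEquiv.ofInjective (l2ToDistribution d)
        (l2ToDistribution_injective d)).symm.toLinearMap ∘ₗ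
      (distributionalLaplacian d).restrict (fun _ hu => hu))

/-- Multiplication by a bounded potential, as an everywhere defined operator on `L²(ℝ^d)`. -/
def multiplicationOperator {d : ℕ} (V : BoundedPotential d) : L2Space d →ₗ[ℂ] L2Space d where
  toFun u := V • u
  map_add' u v := Lp.add_smul V u v
  map_smul' c u := (Lp.smul_comm c V u).symm

/-- The Schrödinger operator `H_V = -Δ + V` on `L²(ℝ^d)`, with the domain of `-Δ`. -/
def schrodingerOperator {d : ℕ} (V : BoundedPotential d) : L2Space d →ₗ.[ℂ] L2Space d :=
  multiplicationOperator V +ᵥ freeHamiltonian d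

/-- `z` is an eigenvalue of the (unbounded) operator `T`: there is a nonzero `ψ` in the domain
of `T` with `T ψ = z ψ`. -/
def IsEigenvalue {d : ℕ} (T : L2Space d →ₗ.[ℂ] L2Space d) (z : ℂ) : Prop :=
  ∃ ψ : T.domain, (ψ : L2Space d) ≠ 0 ∧ T ψ = z • (ψ : L2Space d)

/-- The half line `ℝ₊ = [0, ∞)` as a subset of `ℂ`. -/
def nonnegRealAxis : Set ℂ := Complex.ofReal '' Set.Ici (0 : ℝ)

/-- The tube `{x = (x₁, x') ∈ ℝ × ℝ^(d-1) : |x₁| < ε⁻¹, |x'| < ε^(-1/2)}`. -/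
def tube (d : ℕ) (ε : ℝ) : Set (EuclideanSpace ℝ (Fin d)) :=
  {x | (∀ i : Fin d, i.val = 0 → |x i| < ε⁻¹) ∧
    Real.sqrt (∑ i : Fin d with i.val ≠ 0, x i ^ 2) < ε ^ (-(1 / 2) : ℝ)}

/-- The spectral parameter `z_ε = 1 + i ε`. -/
def zEps (ε : ℝ) : ℂ := 1 + Complex.I * ε

/-- `‖V‖_q^q`, as an extended nonnegative real number. -/
def potentialNormPow {d : ℕ} (q : ℝ) (V : BoundedPotential d) : ℝ≥0∞ :=
  eLpNorm V (ENNReal.ofReal q) volume ^ q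

/-- The eigenvalue bound `dist(z, ℝ₊)^α |z|^β ≤ C ‖V‖_q^q` for all `V ∈ L^∞ ∩ L^q` and all
eigenvalues `z ∈ ℂ \ ℝ₊` of `H_V`. -/
def EigenvalueBound (d : ℕ) (q α β : ℝ) (C : ℝ≥0) : Prop :=
  ∀ V : BoundedPotential d, MemLp V (ENNReal.ofReal q) volume →
    ∀ z : ℂ, z ∉ nonnegRealAxis → IsEigenvalue (schrodingerOperator V) z →
      ENNReal.ofReal (Metric.infDist z nonnegRealAxis ^ α * ‖z‖ ^ β) ≤ C * potentialNormPow q V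

end

/-! Let `R` be the free resolvent at `z = z_ε`. The wave packet `φ = exp(i x_1) Φ(ε x_1, √ε x')`,
with `Φ` a bump supported in the ball of radius 1/2, lives in the tube and satisfies `‖(-Δ - z)φ‖ ≤
C ε ‖φ‖` for `ε ≤ 1`: the phase cancels the energy 1, and every remaining term carries a factor of
at most `ε`. The obvious potential `-(-Δφ - zφ)/φ` is of no use, since it need not be bounded where
`φ` vanishes.

Instead, let `A f` be the complex conjugate of `χ R χ f`, with `χ` the indicator of the tube. This
antilinear operator is compact, because the symbol of `R` decays and the tube has finite volume, and
it is symmetric, because that symbol is even. Takagi's theorem (`exists_antilinear_eigenvector`)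
gives `f ≠ 0` with `A f = ‖A‖ f`. Then `ψ = R f` solves `(-Δ - z)ψ = f = ‖A‖⁻¹ χ conj ψ = -Vψ` with
`V = -‖A‖⁻¹ χ (conj ψ)/ψ`, so that `|V| ≤ ‖A‖⁻¹ χ`. Since `A` sends `(-Δ - z)φ` to `conj φ`, it
follows that `‖A‖⁻¹ ≤ C ε` (`exists_potential_of_approximate_eigenfunction`).

The tube has volume at most a constant times `ε^(-(d+1)/2)`, hence `‖V‖_q^q ≤ K ε^(q-(d+1)/2)`. As
`dist(z, ℝ₊) = ε` and `|z| → 1`, both sharpness claims follow by comparing powers of `ε`. -/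

section

open FourierTransform LineDeriv

variable {d : ℕ}

/-! ### Compactness criteria and Takagi's theorem -/

/-- A bounded operator on a Hilbert space which is square summable on some Hilbert basis
(a Hilbert-Schmidt operator) is compact. -/
theorem isCompactOperator_of_summable_norm_sq {ι H K : Type*} [NormedAddCommGroup H]
    [InnerProductSpace ℂ H] [NormedAddCommGroup K] [NormedSpace ℂ K] [CompleteSpace K]
    (b : HilbertBasis ι ℂ H) (T : H →L[ℂ] K) (hT : Summable fun i => ‖T (b i)‖ ^ 2) :
    IsCompactOperator T := by
  classical
  let S : Finset ι → H →L[ℂ] K := fun F =>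
    ∑ i ∈ F, (innerSL ℂ (b i)).smulRight (T (b i))
  have hS : ∀ F f, S F f = ∑ i ∈ F, inner ℂ (b i) f • T (b i) := by
    intro F f
    simp [S]
  have hcompact : ∀ F, IsCompactOperator (S F) := by
    intro F
    have : S F ∈ compactOperator (RingHom.id ℂ) H K := by
      refine Submodule.sum_mem _ fun i _ => ?_
      exact (isCompactOperator_of_locallyCompactSpace_dom (innerSL ℂ (b i))).clm_comp
        (ContinuousLinearMap.toSpanSingleton ℂ (T (b i)))
    exact this
  refine isCompactOperator_of_tendsto (F := S) (l := atTop) ?_ (Eventually.of_forall hcompact)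
  rw [Metric.tendsto_atTop]
  intro ε hε
  obtain ⟨F₀, hF₀⟩ := summable_iff_vanishing_norm.mp hT ((ε / 2) ^ 2) (by positivity)
  refine ⟨F₀, fun F hF => ?_⟩
  rw [dist_eq_norm, norm_sub_rev]
  refine lt_of_le_of_lt (b := ε / 2) ?_ (by linarith)
  refine ContinuousLinearMap.opNorm_le_bound _ (by positivity) fun f => ?_
  have hsum : HasSum (fun i => inner ℂ (b i) f • T (b i)) (T f) := by
    have := (b.hasSum_repr f).mapL T
    simpa [HilbertBasis.repr_apply_apply] using this
  have hlim : Tendsto (fun G : Finset ι => ‖S G f - S F f‖) atTop (𝓝 ‖T f - S F f‖) := by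
    refine (Tendsto.sub_const ?_ _).norm
    simp only [hS]
    exact hsum
  refine le_of_tendsto hlim ?_
  filter_upwards [eventually_ge_atTop F] with G hG
  have hdiff : S G f - S F f = ∑ i ∈ G \ F, inner ℂ (b i) f • T (b i) := by
    rw [hS, hS, ← Finset.sum_sdiff hG, add_sub_cancel_right]
  rw [hdiff]
  -- Bessel for the coefficients and the small tail of `∑ ‖T b_i‖²` bound the error uniformly in
  -- `f`, so the finite rank truncations converge in operator norm.
  have h1 : ∑ i ∈ G \ F, ‖inner ℂ (b i) f‖ ^ 2 ≤ ‖f‖ ^ 2 :=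
    b.orthonormal.sum_inner_products_le f
  have h2 : ∑ i ∈ G \ F, ‖T (b i)‖ ^ 2 ≤ (ε / 2) ^ 2 := by
    have hdisj : Disjoint (G \ F) F₀ :=
      Finset.disjoint_of_subset_right hF Finset.sdiff_disjoint
    exact (le_abs_self _).trans (hF₀ _ hdisj).le
  calc ‖∑ i ∈ G \ F, inner ℂ (b i) f • T (b i)‖
      ≤ ∑ i ∈ G \ F, ‖inner ℂ (b i) f‖ * ‖T (b i)‖ :=
        norm_sum_le_of_le _ fun i _ => (norm_smul _ _).le
    _ ≤ Real.sqrt (∑ i ∈ G \ F, ‖inner ℂ (b i) f‖ ^ 2) *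
          Real.sqrt (∑ i ∈ G \ F, ‖T (b i)‖ ^ 2) := Real.sum_mul_le_sqrt_mul_sqrt _ _ _
    _ ≤ ‖f‖ * (ε / 2) := by
        gcongr
        · exact Real.sqrt_le_iff.mpr ⟨norm_nonneg _, h1⟩
        · exact Real.sqrt_le_iff.mpr ⟨by positivity, h2⟩
    _ = ε / 2 * ‖f‖ := mul_comm _ _

/-- An operator into `L²(μ)` given by a bounded Hilbert space valued kernel which vanishes off a
set of finite measure is compact. -/
theorem isCompactOperator_of_ae_eq_inner {X H : Type*} [MeasurableSpace X] {μ : Measure X}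
    [NormedAddCommGroup H] [InnerProductSpace ℂ H] [CompleteSpace H]
    (T : H →L[ℂ] Lp ℂ 2 μ) (k : X → H) {s : Set X} (hs : MeasurableSet s) (hμs : μ s ≠ ∞)
    {M : ℝ} (hk : ∀ x, ‖k x‖ ≤ M)
    (hT : ∀ f, ∀ᵐ x ∂μ, T f x = s.indicator (fun y => inner ℂ (k y) f) x) :
    IsCompactOperator T := by
  obtain ⟨w, b, -⟩ := exists_hilbertBasis ℂ H
  refine isCompactOperator_of_summable_norm_sq b T ?_
  -- The squared norms add up under the integral, and Bessel applied to `k x` at each point of `s`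
  -- bounds the integrand by `M²`.
  refine summable_of_sum_le (c := M ^ 2 * μ.real s) (fun _ => by positivity) fun F => ?_
  have hnorm : ∀ i, ‖T (b i)‖ ^ 2 = ∫ x, ‖T (b i) x‖ ^ 2 ∂μ := by
    intro i
    have := L2.inner_def (𝕜 := ℂ) (T (b i)) (T (b i))
    rw [inner_self_eq_norm_sq_to_K] at this
    simp only [inner_self_eq_norm_sq_to_K] at this
    have h2 : (∫ a, ((‖T (b i) a‖ : ℂ)) ^ 2 ∂μ) = ((∫ a, ‖T (b i) a‖ ^ 2 ∂μ : ℝ) : ℂ) := by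
      rw [← integral_complex_ofReal]
      simp
    have h3 := this.trans h2
    exact Complex.ofReal_injective (by simpa using h3)
  have hint : ∀ i, Integrable (fun x => ‖T (b i) x‖ ^ 2) μ := fun i =>
    (Lp.memLp (T (b i))).integrable_norm_pow two_ne_zero
  simp_rw [hnorm]
  rw [← integral_finsetSum _ fun i _ => hint i]
  have hbound : ∫ x, s.indicator (fun _ => M ^ 2) x ∂μ = M ^ 2 * μ.real s := by
    rw [integral_indicator hs, setIntegral_const, smul_eq_mul, mul_comm]
  rw [← hbound]
  refine integral_mono_ae (integrable_finsetSum _ fun i _ => hint i)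
    ((integrable_indicator_iff hs).mpr (integrableOn_const hμs)) ?_
  have hae : ∀ᵐ x ∂μ, ∀ i ∈ F, T (b i) x = s.indicator (fun y => inner ℂ (k y) (b i)) x :=
    (F.eventually_all).mpr fun i _ => hT (b i)
  filter_upwards [hae] with x hx
  have hx' : ∑ i ∈ F, ‖T (b i) x‖ ^ 2
      = ∑ i ∈ F, ‖s.indicator (fun y => inner ℂ (k y) (b i)) x‖ ^ 2 :=
    Finset.sum_congr rfl fun i hi => by rw [hx i hi]
  rw [hx']
  by_cases hxs : x ∈ s
  · simp only [Set.indicator_of_mem hxs]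
    calc ∑ i ∈ F, ‖inner ℂ (k x) (b i)‖ ^ 2
        = ∑ i ∈ F, ‖inner ℂ (b i) (k x)‖ ^ 2 :=
          Finset.sum_congr rfl fun i _ => by rw [norm_inner_symm]
      _ ≤ ‖k x‖ ^ 2 := b.orthonormal.sum_inner_products_le _
      _ ≤ M ^ 2 := by gcongr; exact hk x
  · simp [Set.indicator_of_notMem hxs]

/-- Takagi's theorem for the largest singular value: a compact antilinear operator `A ≠ 0` which is
symmetric, `⟪A f, g⟫ = ⟪A g, f⟫`, satisfies `A f = ‖A‖ f` for some `f ≠ 0`. -/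
theorem exists_antilinear_eigenvector {H : Type*} [NormedAddCommGroup H] [InnerProductSpace ℂ H]
    (A : H →L⋆[ℂ] H) (hA : IsCompactOperator A) (hA0 : A ≠ 0)
    (hsymm : ∀ f g, inner ℂ (A f) g = inner ℂ (A g) f) :
    ∃ f : H, f ≠ 0 ∧ A f = (‖A‖ : ℂ) • f := by
  set s := ‖A‖ with hs
  have hs0 : 0 < s := norm_pos_iff.mpr hA0
  have hbd : ∀ f, ‖A f‖ ≤ s * ‖f‖ := fun f => A.le_opNorm f
  have hseq : ∀ n : ℕ, ∃ f : H, ‖f‖ ≤ 1 ∧ s - 1 / (n + 1) < ‖A f‖ := by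
    intro n
    have hlt : s - 1 / (n + 1 : ℝ) < ‖A‖ := by
      have : (0 : ℝ) < 1 / (n + 1) := by positivity
      linarith
    obtain ⟨f, hf1, hf2⟩ := ContinuousLinearMap.exists_lt_apply_of_lt_opNorm A hlt
    exact ⟨f, hf1.le, hf2⟩
  choose f hf1 hf2 using hseq
  have hnormA : Tendsto (fun n => ‖A (f n)‖) atTop (𝓝 s) := by
    have h1 : Tendsto (fun n : ℕ => s - 1 / ((n : ℝ) + 1)) atTop (𝓝 (s - 0)) :=
      tendsto_const_nhds.sub tendsto_one_div_add_atTop_nhds_zero_nat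
    rw [sub_zero] at h1
    refine tendsto_of_tendsto_of_tendsto_of_le_of_le h1 tendsto_const_nhds
      (fun n => (hf2 n).le) fun n => ?_
    exact (hbd _).trans (mul_le_of_le_one_right hs0.le (hf1 n))
  -- Symmetry gives `⟪A²f, f⟫ = ‖A f‖²`; expanding the square then shows that near-maximizers of `‖A
  -- f‖` are approximate eigenvectors of `A²` for `s²`.
  have hsq : ∀ n, ‖A (A (f n)) - ((s ^ 2 : ℝ) : ℂ) • f n‖ ^ 2
      ≤ 2 * s ^ 2 * (s ^ 2 - ‖A (f n)‖ ^ 2) := by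
    intro n
    have hin : inner ℂ (A (A (f n))) (f n) = ((‖A (f n)‖ ^ 2 : ℝ) : ℂ) := by
      rw [hsymm, inner_self_eq_norm_sq_to_K]
      simp
    have h1 : ‖A (A (f n))‖ ≤ s * ‖A (f n)‖ := hbd _
    have h2 : ‖A (f n)‖ ≤ s := (hbd _).trans (mul_le_of_le_one_right hs0.le (hf1 n))
    have h3 : ‖A (A (f n))‖ ≤ s ^ 2 := by
      calc _ ≤ _ := h1
        _ ≤ s * s := by gcongr
        _ = s ^ 2 := by ring
    have h4 := @norm_sub_sq ℂ H _ _ _ (A (A (f n))) (((s ^ 2 : ℝ) : ℂ) • f n)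
    rw [inner_smul_right, hin, ← Complex.ofReal_mul, norm_smul] at h4
    rw [h4]
    have h5 : RCLike.re (((s ^ 2 * ‖A (f n)‖ ^ 2 : ℝ)) : ℂ) = s ^ 2 * ‖A (f n)‖ ^ 2 :=
      Complex.ofReal_re _
    rw [h5, Complex.norm_real, Real.norm_of_nonneg (by positivity : (0 : ℝ) ≤ s ^ 2)]
    have h6 : (s ^ 2 * ‖f n‖) ^ 2 ≤ (s ^ 2) ^ 2 := by
      gcongr
      exact mul_le_of_le_one_right (by positivity) (hf1 n)
    have h7 : ‖A (A (f n))‖ ^ 2 ≤ (s ^ 2) ^ 2 := by gcongr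
    nlinarith
  have hdiff : Tendsto (fun n => A (A (f n)) - ((s ^ 2 : ℝ) : ℂ) • f n) atTop (𝓝 0) := by
    rw [tendsto_zero_iff_norm_tendsto_zero]
    have h1 : Tendsto (fun n => 2 * s ^ 2 * (s ^ 2 - ‖A (f n)‖ ^ 2)) atTop
        (𝓝 (2 * s ^ 2 * (s ^ 2 - s ^ 2))) :=
      (tendsto_const_nhds.sub (hnormA.pow 2)).const_mul _
    rw [sub_self, mul_zero] at h1
    have h2 := squeeze_zero (fun n => by positivity) hsq h1
    have h3 := h2.sqrt
    simpa using h3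
  obtain ⟨K, hK, hKsub⟩ := 
    IsCompactOperator.image_closedBall_subset_compact (f := (A : H →ₛₗ[starRingEnd ℂ] H)) hA 1
  obtain ⟨h, -, φ, hφ, hlim⟩ := hK.tendsto_subseq (x := fun n => A (f n)) fun n =>
    hKsub ⟨f n, by simpa using hf1 n, rfl⟩
  have hh : ‖h‖ = s :=
    tendsto_nhds_unique hlim.norm (hnormA.comp hφ.tendsto_atTop)
  have hAA : Tendsto (fun n => A (A (f (φ n)))) atTop (𝓝 (A h)) :=
    (A.continuous.tendsto h).comp hlim
  have hsf : Tendsto (fun n => ((s ^ 2 : ℝ) : ℂ) • f (φ n)) atTop (𝓝 (A h)) := by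
    have := hAA.sub (hdiff.comp hφ.tendsto_atTop)
    simpa using this
  have hsA : Tendsto (fun n => A (((s ^ 2 : ℝ) : ℂ) • f (φ n))) atTop (𝓝 (A (A h))) :=
    (A.continuous.tendsto _).comp hsf
  have heq : A (A h) = ((s ^ 2 : ℝ) : ℂ) • h := by
    refine tendsto_nhds_unique hsA ?_
    have := hlim.const_smul ((s ^ 2 : ℝ) : ℂ)
    simpa [Function.comp_def] using this
  -- From `A² h = s² h`, the vector `A h + s h` is fixed up to the factor `s`. If it vanishes, then
  -- `A h = -s h`, and multiplying `h` by `i` flips the sign by antilinearity.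
  by_cases hg : A h + (s : ℂ) • h = 0
  · refine ⟨Complex.I • h, ?_, ?_⟩
    · intro h0
      rw [smul_eq_zero] at h0
      rcases h0 with h0 | h0
      · exact Complex.I_ne_zero h0
      · rw [h0, norm_zero] at hh
        exact hs0.ne hh
    · have : A h = -((s : ℂ) • h) := eq_neg_of_add_eq_zero_left hg
      rw [map_smulₛₗ, this, Complex.conj_I, neg_smul_neg, smul_comm]
  · refine ⟨_, hg, ?_⟩
    rw [map_add, heq, map_smulₛₗ, smul_add, smul_smul, add_comm]
    congr 1
    · simp
    · push_cast
      ring_nf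

/-! ### Multiplication operators and complex conjugation on `L²` -/

/-- Multiplication by a bounded function, as a bounded operator on `L²(ℝ^d)`. -/
noncomputable def boundedMul (g : BoundedPotential d) : L2Space d →L[ℂ] L2Space d :=
  (multiplicationOperator g).mkContinuous ‖g‖ fun f => Lp.norm_smul_le g f

theorem boundedMul_apply (g : BoundedPotential d) (f : L2Space d) : boundedMul g f = g • f := rfl

theorem coeFn_boundedMul (g : BoundedPotential d) (f : L2Space d) :
    ∀ᵐ x, boundedMul g f x = g x * f x := Lp.coeFn_lpSMul (r := 2) g f

theorem coeFn_boundedMul_toLp {g : EuclideanSpace ℝ (Fin d) → ℂ} (hg : MemLp g ∞ volume)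
    (f : L2Space d) : ∀ᵐ x, boundedMul (hg.toLp g) f x = g x * f x := by
  filter_upwards [coeFn_boundedMul (hg.toLp g) f, hg.coeFn_toLp] with x h1 h2
  rw [h1, h2]

/-- Complex conjugation on `L²(ℝ^d)`. -/
noncomputable def conjL2 (d : ℕ) : L2Space d →L⋆[ℂ] L2Space d :=
  LinearMap.mkContinuous
    { toFun := fun f => star f
      map_add' := fun f g => by
        refine Lp.ext ?_
        filter_upwards [Lp.coeFn_star (f + g), Lp.coeFn_add f g, Lp.coeFn_star f, Lp.coeFn_star g,
          Lp.coeFn_add (star f) (star g)] with x h1 h2 h3 h4 h5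
        rw [h1, h5, Pi.star_apply, h2, Pi.add_apply, Pi.add_apply, h3, h4]
        simp
      map_smul' := fun c f => by
        refine Lp.ext ?_
        filter_upwards [Lp.coeFn_star (c • f), Lp.coeFn_smul c f, Lp.coeFn_star f,
          Lp.coeFn_smul ((starRingEnd ℂ) c) (star f)] with x h1 h2 h3 h4
        rw [h1, h4, Pi.star_apply, h2, Pi.smul_apply, Pi.smul_apply, h3]
        simp }
    1 fun f => by
      refine Lp.norm_le_mul_norm_of_ae_le_mul ?_
      filter_upwards [Lp.coeFn_star f] with x h
      simp only [LinearMap.coe_mk, AddHom.coe_mk]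
      rw [h]
      simp

theorem coeFn_conjL2 (f : L2Space d) : ∀ᵐ x, conjL2 d f x = (starRingEnd ℂ) (f x) :=
  Lp.coeFn_star f

theorem norm_conjL2 (f : L2Space d) : ‖conjL2 d f‖ = ‖f‖ := by
  rw [Lp.norm_def, Lp.norm_def]
  congr 1
  refine eLpNorm_congr_norm_ae ?_
  filter_upwards [coeFn_conjL2 f] with x h
  rw [h, RCLike.norm_conj]

theorem inner_conjL2_left (f g : L2Space d) : inner ℂ (conjL2 d f) g = ∫ x, f x * g x := by
  rw [L2.inner_def]
  refine integral_congr_ae ?_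
  filter_upwards [coeFn_conjL2 f] with x h
  rw [h]
  simp [mul_comm]

/-! ### The Fourier transform on `L²` and compactness -/

theorem integrable_schwartz_mul (φ : 𝓢(EuclideanSpace ℝ (Fin d), ℂ)) (f : L2Space d) :
    Integrable (fun x => φ x * f x) :=
  MemLp.integrable_mul (φ.memLp 2) (Lp.memLp f)

/-- On `L¹ ∩ L²` the Plancherel transform is given by the Fourier integral. -/
theorem coeFn_fourier_of_integrable (f : L2Space d) (hf : Integrable f) :
    ∀ᵐ ξ, (𝓕 f : L2Space d) ξ = 𝓕 (f : EuclideanSpace ℝ (Fin d) → ℂ) ξ := by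
  have hL : Continuous fun p : EuclideanSpace ℝ (Fin d) × EuclideanSpace ℝ (Fin d) =>
      innerₗ (EuclideanSpace ℝ (Fin d)) p.1 p.2 := continuous_inner
  have hcont : Continuous (𝓕 (f : EuclideanSpace ℝ (Fin d) → ℂ)) :=
    VectorFourier.fourierIntegral_continuous Real.continuous_fourierChar hL hf
  refine ae_eq_of_integral_contDiff_smul_eq
    ((Lp.memLp _).locallyIntegrable (by norm_num)) hcont.locallyIntegrable fun g hg hgc => ?_
  have hg₁ : HasCompactSupport (Complex.ofRealCLM ∘ g) := hgc.comp_left rfl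
  have hg₂ : ContDiff ℝ ((⊤ : ℕ∞) : WithTop ℕ∞) (Complex.ofRealCLM ∘ g) := by fun_prop
  set φ := hg₁.toSchwartzMap hg₂ with hφ
  have hφg : ∀ x, φ x = (g x : ℂ) := fun x => rfl
  have h1 := congrArg (fun T : 𝓢'(EuclideanSpace ℝ (Fin d), ℂ) => T φ)
    (Lp.fourier_toTemperedDistribution_eq f)
  simp only [TemperedDistribution.fourier_apply, Lp.toTemperedDistribution_apply,
    smul_eq_mul] at h1
  have h2 := VectorFourier.integral_fourierIntegral_smul_eq_flip (μ := volume) (ν := volume)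
    (L := innerₗ (EuclideanSpace ℝ (Fin d))) Real.continuous_fourierChar hL
    (φ.integrable (μ := volume)) hf
  rw [flip_innerₗ] at h2
  simp only [Complex.real_smul, ← hφg]
  rw [← h1]
  exact h2

/-- The symbol of a Fourier multiplier which is small off sets of finite measure gives a compact
operator after localization to a set of finite measure. -/
theorem isCompactOperator_boundedMul_fourier_indicator
    {s : Set (EuclideanSpace ℝ (Fin d))} (hs : MeasurableSet s) (hμs : volume s ≠ ∞)
    {χ : BoundedPotential d} (hχ : ∀ᵐ x, χ x = s.indicator (fun _ => (1 : ℂ)) x)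
    {m : EuclideanSpace ℝ (Fin d) → ℂ} (hm : MemLp m ∞ volume)
    (hdecay : ∀ δ : ℝ, 0 < δ → ∃ t : Set (EuclideanSpace ℝ (Fin d)), MeasurableSet t ∧
      volume t ≠ ∞ ∧ ∀ ξ, ξ ∉ t → ‖m ξ‖ ≤ δ) :
    IsCompactOperator (boundedMul (hm.toLp m) ∘L fourierCLM ℂ (L2Space d) ∘L boundedMul χ) := by
  set P : L2Space d →L[ℂ] L2Space d := fourierCLM ℂ (L2Space d) ∘L boundedMul χ with hP
  -- With a cutoff in frequency as well, the operator has the kernel `exp(-2πi x·ξ)` on `t × s`,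
  -- whose slices in `x` have bounded `L²` norm.
  have hPcompact : ∀ t : Set (EuclideanSpace ℝ (Fin d)), ∀ ht : MeasurableSet t, volume t ≠ ∞ →
      ∀ h1 : MemLp (t.indicator fun _ => (1 : ℂ)) ∞ volume,
      IsCompactOperator (boundedMul (h1.toLp _) ∘L P) := by
    intro t ht hμt h1
    have hmeas : ∀ ξ : EuclideanSpace ℝ (Fin d), AEStronglyMeasurable
        (s.indicator fun x => Complex.exp (((2 * Real.pi * inner ℝ x ξ : ℝ) : ℂ) * Complex.I))
        volume := by
      intro ξ
      refine AEStronglyMeasurable.indicator ?_ hs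
      exact Continuous.aestronglyMeasurable (by fun_prop)
    have hle : ∀ ξ x : EuclideanSpace ℝ (Fin d),
        ‖s.indicator (fun x => Complex.exp (((2 * Real.pi * inner ℝ x ξ : ℝ) : ℂ) * Complex.I)) x‖
          ≤ ‖s.indicator (fun _ => (1 : ℂ)) x‖ := by
      intro ξ x
      by_cases hx : x ∈ s
      · simp only [Set.indicator_of_mem hx, Complex.norm_exp_ofReal_mul_I, norm_one, le_refl]
      · simp [Set.indicator_of_notMem hx]
    have hone : MemLp (s.indicator fun _ => (1 : ℂ)) 2
        (volume : Measure (EuclideanSpace ℝ (Fin d))) := memLp_indicator_const 2 hs 1 (Or.inr hμs)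
    have hmem : ∀ ξ : EuclideanSpace ℝ (Fin d), MemLp
        (s.indicator fun x => Complex.exp (((2 * Real.pi * inner ℝ x ξ : ℝ) : ℂ) * Complex.I)) 2
        volume := fun ξ => hone.of_le (hmeas ξ) (Eventually.of_forall (hle ξ))
    refine isCompactOperator_of_ae_eq_inner _ (fun ξ => (hmem ξ).toLp _) ht hμt
      (M := ‖hone.toLp _‖) (fun ξ => ?_) fun f => ?_
    · refine Lp.norm_le_norm_of_ae_le ?_
      filter_upwards [(hmem ξ).coeFn_toLp, hone.coeFn_toLp] with x hx1 hx2
      rw [hx1, hx2]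
      exact hle ξ x
    · have hχf : ∀ᵐ x, boundedMul χ f x = s.indicator (fun _ => (1 : ℂ)) x * f x := by
        filter_upwards [coeFn_boundedMul χ f, hχ] with x hx1 hx2
        rw [hx1, hx2]
      have hint : Integrable (boundedMul χ f) := by
        refine Integrable.congr ?_ (EventuallyEq.symm hχf)
        exact MemLp.integrable_mul hone (Lp.memLp f)
      filter_upwards [coeFn_boundedMul_toLp h1 (P f), coeFn_fourier_of_integrable _ hint]
        with ξ hξ1 hξ2
      have hPξ : P f ξ = 𝓕 (boundedMul χ f : EuclideanSpace ℝ (Fin d) → ℂ) ξ := hξ2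
      rw [ContinuousLinearMap.comp_apply, hξ1, hPξ]
      by_cases hξ : ξ ∈ t
      · rw [Set.indicator_of_mem hξ, Set.indicator_of_mem hξ, one_mul, Real.fourier_eq',
          L2.inner_def]
        refine integral_congr_ae ?_
        filter_upwards [hχf, (hmem ξ).coeFn_toLp] with x hx1 hx2
        rw [hx1, hx2]
        by_cases hx : x ∈ s
        · simp only [Set.indicator_of_mem hx, one_mul, smul_eq_mul, RCLike.inner_apply]
          rw [← Complex.exp_conj, mul_comm, map_mul, Complex.conj_ofReal, Complex.conj_I]
          simp
        · simp [Set.indicator_of_notMem hx]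
      · rw [Set.indicator_of_notMem hξ, Set.indicator_of_notMem hξ, zero_mul]
  have hclosed := isClosed_setOfPred_isCompactOperator (σ₁₂ := RingHom.id ℂ) (M₁ := L2Space d)
    (M₂ := L2Space d)
  refine hclosed.closure_subset (Metric.mem_closure_iff.mpr fun ε hε => ?_)
  -- Truncating the multiplier to `t` costs at most `ε/2` in operator norm; the `+ 1` covers `P =
  -- 0`.
  obtain ⟨t, ht, hμt, hmt⟩ := hdecay (ε / (2 * (‖P‖ + 1))) (by positivity)
  have h1 : MemLp (t.indicator fun _ => (1 : ℂ)) ∞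
      (volume : Measure (EuclideanSpace ℝ (Fin d))) := (memLp_top_const 1).indicator ht
  refine ⟨boundedMul (hm.toLp m) ∘L boundedMul (h1.toLp _) ∘L P,
    (hPcompact t ht hμt h1).clm_comp (boundedMul (hm.toLp m)), ?_⟩
  rw [dist_eq_norm]
  refine lt_of_le_of_lt (b := ε / 2) ?_ (by linarith)
  refine ContinuousLinearMap.opNorm_le_bound _ (by positivity) fun f => ?_
  have hstep : ‖boundedMul (hm.toLp m) (P f) - boundedMul (hm.toLp m)
      (boundedMul (h1.toLp _) (P f))‖ ≤ ε / (2 * (‖P‖ + 1)) * ‖P f‖ := by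
    refine Lp.norm_le_mul_norm_of_ae_le_mul ?_
    filter_upwards [Lp.coeFn_sub (boundedMul (hm.toLp m) (P f)) (boundedMul (hm.toLp m)
      (boundedMul (h1.toLp _) (P f))), coeFn_boundedMul_toLp hm (P f),
      coeFn_boundedMul_toLp hm (boundedMul (h1.toLp _) (P f)),
      coeFn_boundedMul_toLp h1 (P f)] with ξ e1 e2 e3 e4
    rw [e1, Pi.sub_apply, e2, e3, e4]
    by_cases hξ : ξ ∈ t
    · simp only [Set.indicator_of_mem hξ, one_mul, sub_self, norm_zero]
      positivity
    · simp only [Set.indicator_of_notMem hξ, zero_mul, mul_zero, sub_zero, norm_mul]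
      gcongr
      exact hmt ξ hξ
  refine hstep.trans ?_
  calc ε / (2 * (‖P‖ + 1)) * ‖P f‖ ≤ ε / (2 * (‖P‖ + 1)) * (‖P‖ * ‖f‖) := by
        gcongr; exact P.le_opNorm f
    _ ≤ ε / (2 * (‖P‖ + 1)) * ((‖P‖ + 1) * ‖f‖) := by gcongr; linarith
    _ = ε / 2 * ‖f‖ := by field_simp

/-! ### The free resolvent -/

/-- The symbol `(4π²|ξ|² - z)⁻¹` of the free resolvent. -/
noncomputable def resolventSymbol (d : ℕ) (z : ℂ) (ξ : EuclideanSpace ℝ (Fin d)) : ℂ :=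
  (((2 * Real.pi * ‖ξ‖) ^ 2 : ℝ) - z)⁻¹

theorem symbol_ne_zero {z : ℂ} (hz : z.im ≠ 0) (r : ℝ) : (r : ℂ) - z ≠ 0 := by
  intro h
  apply hz
  have := congrArg Complex.im h
  simpa using this

theorem memLp_resolventSymbol {z : ℂ} (hz : z.im ≠ 0) : MemLp (resolventSymbol d z) ∞ volume := by
  have hc : Continuous (resolventSymbol d z) := by
    unfold resolventSymbol
    exact Continuous.inv₀ (by fun_prop) fun ξ => symbol_ne_zero hz _
  refine memLp_top_of_bound hc.aestronglyMeasurable |z.im|⁻¹ (Eventually.of_forall fun ξ => ?_)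
  rw [resolventSymbol, norm_inv]
  gcongr
  have := Complex.abs_im_le_norm ((((2 * Real.pi * ‖ξ‖) ^ 2 : ℝ) : ℂ) - z)
  rwa [Complex.sub_im, Complex.ofReal_im, zero_sub, abs_neg] at this

theorem resolventSymbol_decay (z : ℂ) (δ : ℝ) (hδ : 0 < δ) :
    ∃ t : Set (EuclideanSpace ℝ (Fin d)), MeasurableSet t ∧ volume t ≠ ∞ ∧
      ∀ ξ, ξ ∉ t → ‖resolventSymbol d z ξ‖ ≤ δ := by
  -- The summand 1 forces `‖ξ‖ ≥ 1` off the ball, so `(2π‖ξ‖)² ≥ ‖ξ‖`; the other two leave at least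
  -- `δ⁻¹` after subtracting `‖z‖`.
  refine ⟨Metric.closedBall 0 (‖z‖ + δ⁻¹ + 1), Metric.isClosed_closedBall.measurableSet,
    measure_closedBall_lt_top.ne, fun ξ hξ => ?_⟩
  have hξ' : ‖z‖ + δ⁻¹ + 1 < ‖ξ‖ := by simpa using hξ
  have hδ' : 0 < δ⁻¹ := by positivity
  have h0 := norm_nonneg z
  have hpi : 1 ≤ 2 * Real.pi := by linarith [Real.pi_gt_three]
  have h1 : ‖ξ‖ ≤ (2 * Real.pi * ‖ξ‖) ^ 2 := by
    have : ‖ξ‖ ≤ 2 * Real.pi * ‖ξ‖ := le_mul_of_one_le_left (norm_nonneg _) hpi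
    nlinarith
  rw [resolventSymbol, norm_inv]
  refine inv_le_of_inv_le₀ hδ ?_
  have h2 := norm_sub_norm_le (((2 * Real.pi * ‖ξ‖) ^ 2 : ℝ) : ℂ) z
  rw [Complex.norm_real, Real.norm_of_nonneg (by positivity)] at h2
  linarith

/-- The free resolvent `(-Δ - z)⁻¹` on `L²(ℝ^d)`. -/
noncomputable def freeResolvent (d : ℕ) {z : ℂ} (hz : z.im ≠ 0) : L2Space d →L[ℂ] L2Space d :=
  fourierInvCLM ℂ (L2Space d) ∘L boundedMul ((memLp_resolventSymbol hz).toLp _) ∘L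
    fourierCLM ℂ (L2Space d)

theorem fourier_freeResolvent {z : ℂ} (hz : z.im ≠ 0) (f : L2Space d) :
    𝓕 (freeResolvent d hz f) = boundedMul ((memLp_resolventSymbol hz).toLp _) (𝓕 f) :=
  fourier_fourierInv_eq _

theorem coeFn_fourier_freeResolvent {z : ℂ} (hz : z.im ≠ 0) (f : L2Space d) :
    ∀ᵐ ξ, (𝓕 (freeResolvent d hz f) : L2Space d) ξ = resolventSymbol d z ξ * (𝓕 f : L2Space d) ξ := by
  rw [fourier_freeResolvent]
  exact coeFn_boundedMul_toLp _ _

theorem l2ToDistribution_apply (f : L2Space d) (φ : 𝓢(EuclideanSpace ℝ (Fin d), ℂ)) :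
    l2ToDistribution d f φ = ∫ x, φ x * f x :=
  Lp.toTemperedDistribution_apply f φ

/-- Bilinear Parseval: identities for the resolvent become pointwise identities between symbols. -/
theorem l2ToDistribution_apply_eq_fourier (f : L2Space d) (φ : 𝓢(EuclideanSpace ℝ (Fin d), ℂ)) :
    l2ToDistribution d f φ = ∫ ξ, (𝓕⁻ φ) ξ * (𝓕 f : L2Space d) ξ := by
  have h := congrArg (fun T : 𝓢'(EuclideanSpace ℝ (Fin d), ℂ) => T (𝓕⁻ φ))
    (Lp.fourier_toTemperedDistribution_eq f)
  simp only [TemperedDistribution.fourier_apply, fourier_fourierInv_eq,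
    Lp.toTemperedDistribution_apply, smul_eq_mul] at h
  rw [l2ToDistribution_apply, h]

theorem fourier_laplacian_apply (φ : 𝓢(EuclideanSpace ℝ (Fin d), ℂ))
    (ξ : EuclideanSpace ℝ (Fin d)) :
    (𝓕 (Δ φ) : 𝓢(EuclideanSpace ℝ (Fin d), ℂ)) ξ
      = -(((2 * Real.pi * ‖ξ‖) ^ 2 : ℝ) : ℂ) * (𝓕 φ : 𝓢(EuclideanSpace ℝ (Fin d), ℂ)) ξ := by
  have hg : Function.HasTemperateGrowth (fun x : EuclideanSpace ℝ (Fin d) => ‖x‖ ^ 2) := by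
    fun_prop
  rw [SchwartzMap.laplacian_eq_fourierMultiplierCLM, SchwartzMap.fourierMultiplierCLM_apply,
    fourier_smul, fourier_fourierInv_eq, smul_apply,
    SchwartzMap.smulLeftCLM_apply_apply hg]
  simp only [Complex.real_smul]
  push_cast
  ring

theorem fourierInv_laplacian_apply (φ : 𝓢(EuclideanSpace ℝ (Fin d), ℂ))
    (ξ : EuclideanSpace ℝ (Fin d)) :
    (𝓕⁻ (Δ φ) : 𝓢(EuclideanSpace ℝ (Fin d), ℂ)) ξ
      = -(((2 * Real.pi * ‖ξ‖) ^ 2 : ℝ) : ℂ) * (𝓕⁻ φ : 𝓢(EuclideanSpace ℝ (Fin d), ℂ)) ξ := by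
  have h : ∀ ψ : 𝓢(EuclideanSpace ℝ (Fin d), ℂ),
      (𝓕⁻ ψ) ξ = (𝓕 ψ : 𝓢(EuclideanSpace ℝ (Fin d), ℂ)) (-ξ) := by
    intro ψ
    rw [SchwartzMap.fourierInv_apply_eq]
    rfl
  rw [h, h, fourier_laplacian_apply, norm_neg]

/-- The free resolvent maps into `H²` and inverts `-Δ - z` from the right. -/
theorem distributionalLaplacian_freeResolvent {z : ℂ} (hz : z.im ≠ 0) (f : L2Space d) :
    distributionalLaplacian d (freeResolvent d hz f)
      = l2ToDistribution d (-(f + z • freeResolvent d hz f)) := by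
  ext φ
  set u := freeResolvent d hz f with hu
  have h1 : distributionalLaplacian d u φ = l2ToDistribution d u (Δ φ) :=
    TemperedDistribution.laplacian_apply_apply _ _
  have h2 : l2ToDistribution d (-(f + z • u)) φ
      = -(l2ToDistribution d f φ + z * l2ToDistribution d u φ) := by
    simp
  rw [h1, h2]
  simp only [l2ToDistribution_apply_eq_fourier]
  rw [← integral_const_mul, ← integral_add (integrable_schwartz_mul _ _)
    ((integrable_schwartz_mul _ _).const_mul z), ← integral_neg]
  refine integral_congr_ae ?_
  filter_upwards [coeFn_fourier_freeResolvent hz f] with ξ hξ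
  rw [fourierInv_laplacian_apply, ← hu] at *
  rw [hξ, resolventSymbol]
  have hne := symbol_ne_zero hz ((2 * Real.pi * ‖ξ‖) ^ 2)
  generalize (2 * Real.pi * ‖ξ‖) ^ 2 = r at hne ⊢
  field_simp
  ring

/-- The free resolvent inverts `-Δ - z` from the left on Schwartz functions. -/
theorem freeResolvent_toLp {z : ℂ} (hz : z.im ≠ 0) (φ : 𝓢(EuclideanSpace ℝ (Fin d), ℂ)) :
    freeResolvent d hz ((-Δ φ - z • φ).toLp 2) = φ.toLp 2 := by
  have hF : (𝓕 (-Δ φ - z • φ) : 𝓢(EuclideanSpace ℝ (Fin d), ℂ)) = -𝓕 (Δ φ) - z • 𝓕 φ := by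
    have h := map_sub (fourierCLM ℂ 𝓢(EuclideanSpace ℝ (Fin d), ℂ)) (-Δ φ) (z • φ)
    rw [map_neg, map_smul] at h
    exact h
  have key : boundedMul ((memLp_resolventSymbol hz).toLp _)
      (𝓕 ((-Δ φ - z • φ).toLp 2 : L2Space d)) = 𝓕 (φ.toLp 2 volume) := by
    rw [SchwartzMap.toLp_fourier_eq, SchwartzMap.toLp_fourier_eq]
    refine Lp.ext ?_
    filter_upwards [coeFn_boundedMul_toLp (memLp_resolventSymbol hz)
      ((𝓕 (-Δ φ - z • φ)).toLp 2 : L2Space d), (𝓕 (-Δ φ - z • φ)).coeFn_toLp 2 volume,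
      (𝓕 φ).coeFn_toLp 2 volume] with ξ h1 h2 h3
    rw [h1, h2, h3, hF, sub_apply,
      neg_apply, smul_apply, fourier_laplacian_apply, resolventSymbol]
    have hne := symbol_ne_zero hz ((2 * Real.pi * ‖ξ‖) ^ 2)
    rw [smul_eq_mul]
    generalize (2 * Real.pi * ‖ξ‖) ^ 2 = r at hne ⊢
    field_simp
  have h := congrArg (fun g : L2Space d => 𝓕⁻ g) key
  exact h.trans (fourierInv_fourier_eq _)

/-- The free resolvent is symmetric for the bilinear pairing `∫ f g`. -/
theorem inner_conj_freeResolvent {z : ℂ} (hz : z.im ≠ 0) (f g : L2Space d) :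
    inner ℂ (conjL2 d (freeResolvent d hz f)) g
      = inner ℂ (conjL2 d (freeResolvent d hz g)) f := by
  have hschwartz : ∀ φ ψ : 𝓢(EuclideanSpace ℝ (Fin d), ℂ),
      inner ℂ (conjL2 d (freeResolvent d hz (φ.toLp 2 volume))) (ψ.toLp 2 volume)
        = ∫ ξ, resolventSymbol d z ξ * (𝓕⁻ ψ) ξ * (𝓕 φ : 𝓢(EuclideanSpace ℝ (Fin d), ℂ)) ξ := by
    intro φ ψ
    have h1 : inner ℂ (conjL2 d (freeResolvent d hz (φ.toLp 2 volume))) (ψ.toLp 2 volume)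
        = l2ToDistribution d (freeResolvent d hz (φ.toLp 2 volume)) ψ := by
      rw [inner_conjL2_left, l2ToDistribution_apply]
      refine integral_congr_ae ?_
      filter_upwards [ψ.coeFn_toLp 2 volume] with x hx
      rw [hx, mul_comm]
    rw [h1, l2ToDistribution_apply_eq_fourier]
    have h2 := coeFn_fourier_freeResolvent hz (φ.toLp 2 volume)
    rw [SchwartzMap.toLp_fourier_eq] at h2
    refine integral_congr_ae ?_
    filter_upwards [h2, (𝓕 φ).coeFn_toLp 2 volume] with ξ h3 h4
    rw [h3, h4]
    ring
  have hS : ∀ φ ψ : 𝓢(EuclideanSpace ℝ (Fin d), ℂ),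
      inner ℂ (conjL2 d (freeResolvent d hz (φ.toLp 2 volume))) (ψ.toLp 2 volume)
        = inner ℂ (conjL2 d (freeResolvent d hz (ψ.toLp 2 volume))) (φ.toLp 2 volume) := by
    intro φ ψ
    -- The symbol is even, so `ξ ↦ -ξ` exchanges the roles of `φ` and `ψ`.
    rw [hschwartz, hschwartz, ← integral_neg_eq_self]
    congr 1
    ext ξ
    have h1 : ∀ θ : 𝓢(EuclideanSpace ℝ (Fin d), ℂ), ∀ η,
        (𝓕⁻ θ) η = (𝓕 θ : 𝓢(EuclideanSpace ℝ (Fin d), ℂ)) (-η) := by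
      intro θ η
      rw [SchwartzMap.fourierInv_apply_eq]
      rfl
    rw [h1, h1, neg_neg, resolventSymbol, resolventSymbol, norm_neg]
    ring
  have hdense := SchwartzMap.denseRange_toLpCLM (E := EuclideanSpace ℝ (Fin d)) (F := ℂ)
    (p := 2) (μ := volume) ENNReal.ofNat_ne_top
  refine hdense.induction_on₂ (p := fun f g : L2Space d =>
    inner ℂ (conjL2 d (freeResolvent d hz f)) g = inner ℂ (conjL2 d (freeResolvent d hz g)) f)
    ?_ ?_ f g
  · refine isClosed_eq ?_ ?_
    · fun_prop
    · fun_prop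
  · intro φ ψ
    exact hS φ ψ

/-! ### From resolvents to potentials -/

theorem mem_freeHamiltonian_domain {u g : L2Space d}
    (h : distributionalLaplacian d u = l2ToDistribution d g) : u ∈ (freeHamiltonian d).domain :=
  ⟨g, h.symm⟩

theorem freeHamiltonian_apply {u g : L2Space d}
    (h : distributionalLaplacian d u = l2ToDistribution d g)
    (hu : u ∈ (freeHamiltonian d).domain) : freeHamiltonian d ⟨u, hu⟩ = -g := by
  have h1 : freeHamiltonian d ⟨u, hu⟩ = -((LinearEquiv.ofInjective (l2ToDistribution d)
      (l2ToDistribution_injective d)).symm ⟨distributionalLaplacian d u, hu⟩) := rfl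
  rw [h1, neg_inj]
  apply l2ToDistribution_injective d
  rw [LinearEquiv.ofInjective_symm_apply]
  exact h

/-- If `(-Δ - z)ψ = f = -Vψ` with `f ≠ 0`, then `z` is an eigenvalue of `-Δ + V`. -/
theorem isEigenvalue_of_freeResolvent {z : ℂ} (hz : z.im ≠ 0) {f : L2Space d} (hf : f ≠ 0)
    (V : BoundedPotential d) (hV : V • freeResolvent d hz f = -f) :
    IsEigenvalue (schrodingerOperator V) z := by
  set ψ := freeResolvent d hz f with hψ
  have hlap := distributionalLaplacian_freeResolvent hz f
  rw [← hψ] at hlap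
  have hmem := mem_freeHamiltonian_domain hlap
  refine ⟨⟨ψ, hmem⟩, ?_, ?_⟩
  · intro h0
    have h0' : ψ = 0 := h0
    rw [h0', Lp.smul_zero] at hV
    exact hf (neg_eq_zero.mp hV.symm)
  · have h1 : schrodingerOperator V ⟨ψ, hmem⟩ = V • ψ + freeHamiltonian d ⟨ψ, hmem⟩ := rfl
    have h2 := freeHamiltonian_apply hlap hmem
    rw [h1, h2, hV]
    simp

/-- A Schwartz function vanishing off `s` which is an approximate solution of `-Δφ = zφ` with
relative error `c` yields a potential of size `c` supported in `s` having `z` as an eigenvalue. -/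
theorem exists_potential_of_approximate_eigenfunction {z : ℂ} (hz : z.im ≠ 0)
    {s : Set (EuclideanSpace ℝ (Fin d))} (hs : MeasurableSet s) (hμs : volume s ≠ ∞)
    {φ : 𝓢(EuclideanSpace ℝ (Fin d), ℂ)} (hφ : φ ≠ 0) (hsupp : tsupport φ ⊆ s) {c : ℝ}
    (hc : ‖(-Δ φ - z • φ).toLp 2 volume‖ ≤ c * ‖φ.toLp 2 volume‖) :
    ∃ V : BoundedPotential d, (∀ᵐ x, ‖V x‖ ≤ c * s.indicator (fun _ => (1 : ℝ)) x) ∧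
      IsEigenvalue (schrodingerOperator V) z := by
  have hχmem : MemLp (s.indicator fun _ => (1 : ℂ)) ∞
      (volume : Measure (EuclideanSpace ℝ (Fin d))) := (memLp_top_const 1).indicator hs
  set χ : BoundedPotential d := hχmem.toLp _ with hχ
  have hχae : ∀ᵐ x, χ x = s.indicator (fun _ => (1 : ℂ)) x := hχmem.coeFn_toLp
  have hmul : ∀ f : L2Space d, ∀ᵐ x, boundedMul χ f x = s.indicator (fun _ => (1 : ℂ)) x * f x :=
    fun f => coeFn_boundedMul_toLp hχmem f
  have hχfix : ∀ f : L2Space d, (∀ᵐ x, x ∉ s → f x = 0) → boundedMul χ f = f := by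
    intro f hf
    refine Lp.ext ?_
    filter_upwards [hmul f, hf] with x h1 h2
    rw [h1]
    by_cases hx : x ∈ s
    · simp [Set.indicator_of_mem hx]
    · simp [h2 hx]
  -- The conjugation turns the bilinear symmetry of the resolvent into the symmetry that Takagi's
  -- theorem asks for.
  set A : L2Space d →L⋆[ℂ] L2Space d :=
    (conjL2 d).comp (boundedMul χ ∘L freeResolvent d hz ∘L boundedMul χ) with hA
  have hAapply : ∀ f, A f = conjL2 d (boundedMul χ (freeResolvent d hz (boundedMul χ f))) :=
    fun _ => rfl
  have hcompact : IsCompactOperator A := by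
    have h1 := isCompactOperator_boundedMul_fourier_indicator hs hμs hχae
      (memLp_resolventSymbol (d := d) hz) (resolventSymbol_decay z)
    exact h1.continuous_comp (g := fun f => conjL2 d (boundedMul χ
      (fourierInvCLM ℂ (L2Space d) f))) (by fun_prop)
  have hsymm : ∀ f g, inner ℂ (A f) g = inner ℂ (A g) f := by
    intro f g
    have h1 : ∀ f g : L2Space d, inner ℂ (A f) g
        = inner ℂ (conjL2 d (freeResolvent d hz (boundedMul χ f))) (boundedMul χ g) := by
      intro f g
      rw [hAapply, inner_conjL2_left, inner_conjL2_left]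
      refine integral_congr_ae ?_
      filter_upwards [hmul (freeResolvent d hz (boundedMul χ f)), hmul g] with x e1 e2
      rw [e1, e2]
      ring
    rw [h1, h1, inner_conj_freeResolvent]
  have hφnorm : 0 < ‖φ.toLp 2 volume‖ := by
    rw [norm_pos_iff]
    intro h0
    refine hφ (SchwartzMap.injective_toLp 2 volume (h0.trans ?_))
    exact (map_zero (SchwartzMap.toLpCLM ℂ (E := EuclideanSpace ℝ (Fin d)) ℂ 2 volume)).symm
  -- Both `φ` and its residual vanish off `s`, so the cutoffs do nothing and `A` maps the residual
  -- to `conj φ`.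
  have hAc : 1 ≤ ‖A‖ * c := by
    have hzero : ∀ x, x ∉ s → φ x = 0 ∧ (-Δ φ - z • φ) x = 0 := by
      intro x hx
      have hx' : x ∉ tsupport φ := fun h => hx (hsupp h)
      have h1 := notMem_tsupport_iff_eventuallyEq.mp hx'
      have h2 : Δ φ x = 0 := by
        rw [SchwartzMap.laplacian_apply,
          (InnerProductSpace.laplacian_congr_nhds h1).eq_of_nhds]
        simp [InnerProductSpace.laplacian_eq_iteratedFDeriv_stdOrthonormalBasis]
      have h4 : φ x = 0 := h1.eq_of_nhds
      refine ⟨h4, ?_⟩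
      simp [h2, h4]
    have hAh : A ((-Δ φ - z • φ).toLp 2 volume) = conjL2 d (φ.toLp 2 volume) := by
      rw [hAapply, hχfix ((-Δ φ - z • φ).toLp 2 volume), freeResolvent_toLp,
        hχfix (φ.toLp 2 volume)]
      · filter_upwards [φ.coeFn_toLp 2 volume] with x h1 hx
        rw [h1, (hzero x hx).1]
      · filter_upwards [(-Δ φ - z • φ).coeFn_toLp 2 volume] with x h1 hx
        rw [h1, (hzero x hx).2]
    have h1 := A.le_opNorm ((-Δ φ - z • φ).toLp 2 volume)
    rw [hAh, norm_conjL2] at h1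
    have h2 : ‖φ.toLp 2 volume‖ ≤ ‖A‖ * c * ‖φ.toLp 2 volume‖ :=
      h1.trans ((mul_le_mul_of_nonneg_left hc (norm_nonneg A)).trans_eq (by ring))
    exact le_of_mul_le_mul_right (by linarith) hφnorm
  have hA0 : A ≠ 0 := by
    intro h0
    rw [h0, norm_zero, zero_mul] at hAc
    linarith
  have hApos : 0 < ‖A‖ := norm_pos_iff.mpr hA0
  have hcinv : ‖A‖⁻¹ ≤ c := by
    rw [inv_le_iff_one_le_mul₀ hApos]
    linarith
  obtain ⟨f, hf0, hAf⟩ := exists_antilinear_eigenvector A hcompact hA0 hsymm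
  set σ : ℂ := (‖A‖ : ℂ) with hσ
  have hσ0 : σ ≠ 0 := by simpa [hσ] using hA0
  have hconj : ∀ g : L2Space d, ∀ᵐ x, conjL2 d (boundedMul χ g) x
      = s.indicator (fun _ => (1 : ℂ)) x * (starRingEnd ℂ) (g x) := by
    intro g
    filter_upwards [coeFn_conjL2 (boundedMul χ g), hmul g] with x h1 h2
    rw [h1, h2, map_mul]
    by_cases hx : x ∈ s
    · simp [Set.indicator_of_mem hx]
    · simp [Set.indicator_of_notMem hx]
  have hAfx : ∀ᵐ x, σ * f x = s.indicator (fun _ => (1 : ℂ)) x *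
      (starRingEnd ℂ) (freeResolvent d hz (boundedMul χ f) x) := by
    have h1 := hconj (freeResolvent d hz (boundedMul χ f))
    rw [← hAapply, hAf] at h1
    filter_upwards [h1, Lp.coeFn_smul σ f] with x h2 h3
    rw [← h2, h3]
    rfl
  have hχf : boundedMul χ f = f := by
    refine hχfix f ?_
    filter_upwards [hAfx] with x h1 hx
    rw [Set.indicator_of_notMem hx, zero_mul] at h1
    exact (mul_eq_zero.mp h1).resolve_left hσ0
  rw [hχf] at hAfx
  set ψ := freeResolvent d hz f with hψ
  -- Chosen so that `v ψ = -σ⁻¹ χ conj ψ = -f`. At zeros of `ψ` the quotient is `0` by convention,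
  -- which is consistent because `f` vanishes there too.
  let v : EuclideanSpace ℝ (Fin d) → ℂ :=
    s.indicator fun x => -σ⁻¹ * ((starRingEnd ℂ) (ψ x) / ψ x)
  have hvbound : ∀ x, ‖v x‖ ≤ c * s.indicator (fun _ => (1 : ℝ)) x := by
    intro x
    by_cases hx : x ∈ s
    · simp only [v, Set.indicator_of_mem hx]
      rw [norm_mul, norm_neg, norm_inv, norm_div, RCLike.norm_conj, hσ, Complex.norm_real,
        norm_norm, mul_one]
      calc ‖A‖⁻¹ * (‖ψ x‖ / ‖ψ x‖) ≤ ‖A‖⁻¹ * 1 := by gcongr; exact div_self_le_one _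
        _ ≤ c := by rwa [mul_one]
    · simp [v, Set.indicator_of_notMem hx]
  have hvmeas : AEStronglyMeasurable v volume := by
    have h1 : AEMeasurable (fun x => ψ x) volume := (Lp.aestronglyMeasurable ψ).aemeasurable
    refine AEStronglyMeasurable.indicator ?_ hs
    refine AEMeasurable.aestronglyMeasurable ?_
    exact (((Complex.continuous_conj.measurable.comp_aemeasurable h1).div h1).const_mul _)
  have hc0 : 0 ≤ c := (inv_pos.mpr hApos).le.trans hcinv
  have hvmem : MemLp v ∞ volume := by
    refine memLp_top_of_bound hvmeas c (Eventually.of_forall fun x => (hvbound x).trans ?_)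
    refine mul_le_of_le_one_right hc0 ?_
    by_cases hx : x ∈ s
    · simp [Set.indicator_of_mem hx]
    · simp [Set.indicator_of_notMem hx]
  refine ⟨hvmem.toLp v, ?_, isEigenvalue_of_freeResolvent hz hf0 _ ?_⟩
  · filter_upwards [hvmem.coeFn_toLp] with x hx
    rw [hx]
    exact hvbound x
  · rw [← hψ, ← boundedMul_apply]
    refine Lp.ext ?_
    filter_upwards [coeFn_boundedMul_toLp hvmem ψ, Lp.coeFn_neg f, hAfx] with x h1 h2 h3
    rw [h1, h2, Pi.neg_apply]
    have h4 : f x = σ⁻¹ * (s.indicator (fun _ => (1 : ℂ)) x * (starRingEnd ℂ) (ψ x)) := by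
      rw [← h3, inv_mul_cancel_left₀ hσ0]
    rw [h4]
    by_cases hx : x ∈ s
    · simp only [v, Set.indicator_of_mem hx]
      by_cases h0 : ψ x = 0
      · simp [h0]
      · field_simp
    · simp [v, Set.indicator_of_notMem hx]

/-! ### Wave packets -/

/-- All derivatives are bounded by 1; this is what lets a plane wave act on Schwartz functions. -/
theorem hasTemperateGrowth_exp_mul_I :
    Function.HasTemperateGrowth fun t : ℝ => Complex.exp (t * Complex.I) := by
  have hderiv : ∀ n : ℕ, iteratedDeriv n (fun t : ℝ => Complex.exp (t * Complex.I))
      = fun t : ℝ => Complex.I ^ n * Complex.exp (t * Complex.I) := by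
    intro n
    induction n with
    | zero => ext t; simp
    | succ n ih =>
      rw [iteratedDeriv_succ, ih]
      ext t
      have h1 : HasDerivAt (fun t : ℝ => (t : ℂ) * Complex.I) (1 * Complex.I) t :=
        (Complex.ofRealCLM.hasDerivAt (x := t)).mul_const Complex.I
      rw [(h1.cexp.const_mul (Complex.I ^ n)).deriv]
      ring
  refine ⟨?_, fun n => ⟨0, 1, fun t => ?_⟩⟩
  · have h1 : ContDiff ℝ ((⊤ : ℕ∞) : WithTop ℕ∞) fun t : ℝ => (t : ℂ) * Complex.I :=
      Complex.ofRealCLM.contDiff.mul contDiff_const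
    exact h1.cexp
  · rw [norm_iteratedFDeriv_eq_norm_iteratedDeriv, hderiv, norm_mul, norm_pow, Complex.norm_I,
      one_pow, one_mul, Complex.norm_exp_ofReal_mul_I]
    simp

/-- The plane wave `exp(i x_j)`. -/
noncomputable def planeWave (j : Fin d) (x : EuclideanSpace ℝ (Fin d)) : ℂ :=
  Complex.exp (x j * Complex.I)

theorem hasTemperateGrowth_planeWave (j : Fin d) :
    Function.HasTemperateGrowth (planeWave j) :=
  hasTemperateGrowth_exp_mul_I.comp
    (EuclideanSpace.proj j : EuclideanSpace ℝ (Fin d) →L[ℝ] ℝ).hasTemperateGrowth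

/-- Multiplication of a Schwartz function by the plane wave `exp(i x_j)`. -/
noncomputable def modulate (j : Fin d) :
    𝓢(EuclideanSpace ℝ (Fin d), ℂ) →L[ℂ] 𝓢(EuclideanSpace ℝ (Fin d), ℂ) :=
  SchwartzMap.smulLeftCLM ℂ (planeWave j)

theorem modulate_apply (j : Fin d) (f : 𝓢(EuclideanSpace ℝ (Fin d), ℂ))
    (x : EuclideanSpace ℝ (Fin d)) : modulate j f x = planeWave j x * f x :=
  SchwartzMap.smulLeftCLM_apply_apply (hasTemperateGrowth_planeWave j) f x

/-- Conjugation by the plane wave shifts the derivative by its frequency. -/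
theorem lineDerivOp_modulate (j : Fin d) (m : EuclideanSpace ℝ (Fin d))
    (f : 𝓢(EuclideanSpace ℝ (Fin d), ℂ)) :
    ∂_{m} (modulate j f) = modulate j (∂_{m} f + (m j * Complex.I) • f) := by
  ext x
  rw [SchwartzMap.lineDerivOp_apply_eq_fderiv, modulate_apply]
  have h1 : HasFDerivAt (fun x : EuclideanSpace ℝ (Fin d) => ((x j : ℝ) : ℂ) * Complex.I)
      ((Complex.ofRealCLM ∘L (EuclideanSpace.proj j : EuclideanSpace ℝ (Fin d) →L[ℝ] ℝ)).smulRight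
        Complex.I) x :=
    (Complex.ofRealCLM ∘L
      (EuclideanSpace.proj j : EuclideanSpace ℝ (Fin d) →L[ℝ] ℝ)).hasFDerivAt.mul_const' _
  have h2 : HasFDerivAt (modulate j f) _ x :=
    (h1.cexp.mul (f.hasFDerivAt x)).congr_of_eventuallyEq
      (Eventually.of_forall fun y => modulate_apply j f y)
  rw [h2.fderiv]
  simp [planeWave, SchwartzMap.lineDerivOp_apply_eq_fderiv]
  ring

theorem laplacian_modulate (j : Fin d) (f : 𝓢(EuclideanSpace ℝ (Fin d), ℂ)) :
    Δ (modulate j f) = modulate j (Δ f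
      + (2 * Complex.I) • ∂_{EuclideanSpace.single j (1 : ℝ)} f - f) := by
  rw [SchwartzMap.laplacian_eq_sum (EuclideanSpace.basisFun (Fin d) ℝ),
    SchwartzMap.laplacian_eq_sum (EuclideanSpace.basisFun (Fin d) ℝ)]
  simp only [EuclideanSpace.basisFun_apply, lineDerivOp_modulate, lineDerivOp_add,
    lineDerivOp_smul]
  rw [← map_sum]
  congr 1
  have h : ∀ i : Fin d,
      ∂_{EuclideanSpace.single i (1 : ℝ)} (∂_{EuclideanSpace.single i (1 : ℝ)} f)
        + (((EuclideanSpace.single i (1 : ℝ) : EuclideanSpace ℝ (Fin d)) j : ℂ) * Complex.I) •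
          ∂_{EuclideanSpace.single i (1 : ℝ)} f
        + (((EuclideanSpace.single i (1 : ℝ) : EuclideanSpace ℝ (Fin d)) j : ℂ) * Complex.I) •
          (∂_{EuclideanSpace.single i (1 : ℝ)} f
          + (((EuclideanSpace.single i (1 : ℝ) : EuclideanSpace ℝ (Fin d)) j : ℂ) * Complex.I) • f)
      = ∂_{EuclideanSpace.single i (1 : ℝ)} (∂_{EuclideanSpace.single i (1 : ℝ)} f)
        + if i = j then (2 * Complex.I) • ∂_{EuclideanSpace.single j (1 : ℝ)} f - f else 0 := by
    intro i
    by_cases hij : i = j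
    · subst hij
      ext x
      simp
      linear_combination (f x) * Complex.I_mul_I
    · simp [hij, Ne.symm hij]
  simp only [h, Finset.sum_add_distrib, Finset.sum_ite_eq', Finset.mem_univ, if_true]
  abel

/-- The diagonal linear map `x ↦ (a_i x_i)_i`. -/
noncomputable def diagonalEquiv (a : Fin d → ℝ) (ha : ∀ i, a i ≠ 0) :
    EuclideanSpace ℝ (Fin d) ≃L[ℝ] EuclideanSpace ℝ (Fin d) :=
  LinearEquiv.toContinuousLinearEquiv
    { toFun := fun x => WithLp.toLp 2 fun i => a i * x i
      invFun := fun x => WithLp.toLp 2 fun i => (a i)⁻¹ * x i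
      map_add' := fun x y => by ext i; simp [mul_add]
      map_smul' := fun c x => by ext i; simp; ring
      left_inv := fun x => by ext i; simp [ha i]
      right_inv := fun x => by ext i; simp [ha i] }

theorem diagonalEquiv_apply (a : Fin d → ℝ) (ha : ∀ i, a i ≠ 0) (x : EuclideanSpace ℝ (Fin d))
    (i : Fin d) : diagonalEquiv a ha x i = a i * x i := rfl

theorem diagonalEquiv_single (a : Fin d → ℝ) (ha : ∀ i, a i ≠ 0) (j : Fin d) :
    diagonalEquiv a ha (EuclideanSpace.single j 1) = a j • EuclideanSpace.single j (1 : ℝ) := by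
  ext i
  rw [diagonalEquiv_apply]
  by_cases h : i = j
  · subst h; simp
  · simp [h]

/-- The wave packet `exp(i x_j) Φ(a_1 x_1, …, a_d x_d)`. -/
noncomputable def wavePacket (j : Fin d) (a : Fin d → ℝ) (ha : ∀ i, a i ≠ 0)
    (Φ : 𝓢(EuclideanSpace ℝ (Fin d), ℂ)) : 𝓢(EuclideanSpace ℝ (Fin d), ℂ) :=
  modulate j (SchwartzMap.compCLMOfContinuousLinearEquiv ℂ (diagonalEquiv a ha) Φ)

theorem wavePacket_apply (j : Fin d) (a : Fin d → ℝ) (ha : ∀ i, a i ≠ 0)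
    (Φ : 𝓢(EuclideanSpace ℝ (Fin d), ℂ)) (x : EuclideanSpace ℝ (Fin d)) :
    wavePacket j a ha Φ x = planeWave j x * Φ (diagonalEquiv a ha x) :=
  modulate_apply _ _ _

/-- The term of order zero produced by the phase cancels the 1 in `1 + w`. What remains has
coefficients `a_i²`, `2 a_j` and `w` in modulus, each at most a constant times `ε` for the tube
scaling when `ε ≤ 1`. -/
theorem helmholtz_wavePacket (j : Fin d) (a : Fin d → ℝ) (ha : ∀ i, a i ≠ 0)
    (Φ : 𝓢(EuclideanSpace ℝ (Fin d), ℂ)) (w : ℂ) :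
    -Δ (wavePacket j a ha Φ) - (1 + w) • wavePacket j a ha Φ
      = wavePacket j a ha (-(∑ i, ((a i : ℂ) ^ 2) • ∂_{EuclideanSpace.single i (1 : ℝ)}
          (∂_{EuclideanSpace.single i (1 : ℝ)} Φ))
        - (2 * Complex.I * a j) • ∂_{EuclideanSpace.single j (1 : ℝ)} Φ - w • Φ) := by
  have hd : ∀ (i : Fin d) (Ψ : 𝓢(EuclideanSpace ℝ (Fin d), ℂ)),
      ∂_{EuclideanSpace.single i (1 : ℝ)}
        (SchwartzMap.compCLMOfContinuousLinearEquiv ℂ (diagonalEquiv a ha) Ψ)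
      = (a i : ℂ) • SchwartzMap.compCLMOfContinuousLinearEquiv ℂ (diagonalEquiv a ha)
          (∂_{EuclideanSpace.single i (1 : ℝ)} Ψ) := by
    intro i Ψ
    rw [SchwartzMap.lineDerivOp_compCLMOfContinuousLinearEquiv, diagonalEquiv_single,
      lineDerivOp_left_smul]
    ext x
    simp
  rw [wavePacket, laplacian_modulate,
    SchwartzMap.laplacian_eq_sum (EuclideanSpace.basisFun (Fin d) ℝ), wavePacket,
    ← map_smul, ← map_neg, ← map_sub]
  congr 1
  simp only [EuclideanSpace.basisFun_apply, hd, lineDerivOp_smul, map_sub, map_neg, map_sum,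
    map_smul, smul_smul, add_smul, one_smul, sq]
  abel

/-- The phase is unimodular and the dilation multiplies all `L²` norms by one factor `|det|^(-1/2)`,
which drops out of the relative error. -/
theorem exists_norm_wavePacket_eq (j : Fin d) (a : Fin d → ℝ) (ha : ∀ i, a i ≠ 0) :
    ∃ κ : ℝ, 0 < κ ∧ ∀ Φ : 𝓢(EuclideanSpace ℝ (Fin d), ℂ),
      ‖(wavePacket j a ha Φ).toLp 2 volume‖ = κ * ‖Φ.toLp 2 volume‖ := by
  set D := (diagonalEquiv a ha : EuclideanSpace ℝ (Fin d) →ₗ[ℝ] EuclideanSpace ℝ (Fin d)) with hD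
  have hdet : LinearMap.det D ≠ 0 :=
    (LinearEquiv.isUnit_det' (diagonalEquiv a ha).toLinearEquiv).ne_zero
  refine ⟨(|(LinearMap.det D)⁻¹|) ^ (1 / 2 : ℝ), by positivity, fun Φ => ?_⟩
  rw [SchwartzMap.norm_toLp, SchwartzMap.norm_toLp]
  have h1 : eLpNorm (wavePacket j a ha Φ) 2 volume = eLpNorm (Φ ∘ D) 2 volume := by
    refine eLpNorm_congr_norm_ae (Eventually.of_forall fun x => ?_)
    rw [wavePacket_apply, norm_mul, planeWave, Complex.norm_exp_ofReal_mul_I, one_mul]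
    rfl
  rw [h1, ← eLpNorm_map_measure (f := D) Φ.continuous.aestronglyMeasurable
    (diagonalEquiv a ha).continuous.measurable.aemeasurable,
    Measure.map_linearMap_addHaar_eq_smul_addHaar volume hdet,
    eLpNorm_smul_measure_of_ne_top (by norm_num)]
  rw [smul_eq_mul, ENNReal.toReal_mul, ← ENNReal.toReal_rpow, ENNReal.toReal_ofReal (abs_nonneg _)]
  simp

/-! ### The tube -/

theorem measurableSet_tube (d : ℕ) (ε : ℝ) : MeasurableSet (tube d ε) := by
  have h0 : tube d ε = (⋂ i : Fin d, ⋂ _ : i.val = 0, {x | |x i| < ε⁻¹}) ∩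
      {x | Real.sqrt (∑ i : Fin d with i.val ≠ 0, x i ^ 2) < ε ^ (-(1 / 2) : ℝ)} := by
    ext x
    simp [tube]
  have h1 : IsOpen (tube d ε) := by
    rw [h0]
    refine IsOpen.inter ?_ (isOpen_lt (by fun_prop) continuous_const)
    exact isOpen_iInter_of_finite fun i => isOpen_iInter_of_finite fun _ =>
      isOpen_lt (by fun_prop) continuous_const
  exact h1.measurableSet

theorem volume_tube_le (hd : 0 < d) {ε : ℝ} (hε : 0 < ε) :
    volume (tube d ε) ≤ ENNReal.ofReal (2 ^ d * ε ^ (-(((d : ℝ) + 1) / 2))) := by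
  set j : Fin d := ⟨0, hd⟩ with hj
  have hval : ∀ i : Fin d, i.val = 0 ↔ i = j := fun i => by rw [hj, Fin.ext_iff]
  -- Exponents of the half-widths of an enclosing box: `-1` along the axis, `-1/2` across it, with
  -- sum `-(d+1)/2`.
  let t : Fin d → ℝ := fun i => -(1 / 2) + if i = j then -(1 / 2) else 0
  let b : Fin d → ℝ := fun i => ε ^ t i
  have hb : ∀ i, 0 < b i := fun i => Real.rpow_pos_of_pos hε _
  have hsub : tube d ε ⊆
      (WithLp.ofLp : EuclideanSpace ℝ (Fin d) → Fin d → ℝ) ⁻¹'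
        (Set.univ.pi fun i => Set.Ioo (-(b i)) (b i)) := by
    rintro x ⟨h0, h1⟩ i -
    rw [Set.mem_Ioo, ← abs_lt]
    by_cases hi : i = j
    · have hbi : b i = ε⁻¹ := by
        simp only [b, t, hi, if_true]
        rw [← Real.rpow_neg_one]
        norm_num
      rw [hbi]
      exact h0 i ((hval i).mpr hi)
    · have hbi : b i = ε ^ (-(1 / 2) : ℝ) := by
        simp only [b, t, hi, if_false, add_zero]
      rw [hbi, ← Real.sqrt_sq_eq_abs]
      refine lt_of_le_of_lt (Real.sqrt_le_sqrt ?_) h1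
      refine Finset.single_le_sum (f := fun i => x i ^ 2) (fun _ _ => sq_nonneg _) ?_
      simp [hval, hi]
  have hbox : MeasurableSet (Set.univ.pi fun i => Set.Ioo (-(b i)) (b i)) :=
    MeasurableSet.univ_pi fun i => measurableSet_Ioo
  refine (measure_mono hsub).trans (le_of_eq ?_)
  rw [(PiLp.volume_preserving_ofLp (Fin d)).measure_preimage hbox.nullMeasurableSet,
    Real.volume_pi_Ioo, ← ENNReal.ofReal_prod_of_nonneg fun i _ => by linarith [hb i]]
  congr 1
  have h1 : ∀ i, b i - -b i = 2 * b i := fun i => by ring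
  simp only [h1]
  rw [Finset.prod_mul_distrib, Finset.prod_const, Finset.card_univ, Fintype.card_fin,
    ← Real.rpow_sum_of_pos hε]
  congr 2
  simp only [t, Finset.sum_add_distrib, Finset.sum_const, Finset.card_univ, Fintype.card_fin,
    Finset.sum_ite_eq', Finset.mem_univ, if_true, nsmul_eq_mul]
  ring

/-! ### The spectral parameter -/

theorem zEps_im (ε : ℝ) : (zEps ε).im = ε := by simp [zEps]

theorem infDist_zEps {ε : ℝ} (hε : 0 < ε) : Metric.infDist (zEps ε) nonnegRealAxis = ε := by
  have hone : (1 : ℂ) ∈ nonnegRealAxis := ⟨1, by simp, by simp⟩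
  refine le_antisymm ?_ ?_
  · refine (Metric.infDist_le_dist_of_mem hone).trans ?_
    rw [dist_eq_norm, zEps, add_sub_cancel_left, norm_mul, Complex.norm_I, one_mul,
      Complex.norm_real, Real.norm_of_nonneg hε.le]
  · rw [Metric.le_infDist ⟨1, hone⟩]
    rintro _ ⟨r, -, rfl⟩
    have h1 := Complex.abs_im_le_norm (zEps ε - r)
    rw [Complex.sub_im, zEps_im, Complex.ofReal_im, sub_zero, abs_of_pos hε] at h1
    rwa [dist_eq_norm]

theorem one_le_norm_zEps (ε : ℝ) : 1 ≤ ‖zEps ε‖ := by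
  have h1 := Complex.abs_re_le_norm (zEps ε)
  simpa [zEps] using h1

theorem zEps_notMem_nonnegRealAxis {ε : ℝ} (hε : 0 < ε) : zEps ε ∉ nonnegRealAxis := by
  rintro ⟨r, -, hr⟩
  have h1 := congrArg Complex.im hr
  rw [zEps_im, Complex.ofReal_im] at h1
  exact hε.ne h1

/-! ### The potentials -/

/-- The anisotropic dilation factors of the wave packets. -/
noncomputable def tubeScale (d : ℕ) (ε : ℝ) (i : Fin d) : ℝ :=
  if i.val = 0 then ε else Real.sqrt ε

theorem tubeScale_ne_zero {ε : ℝ} (hε : 0 < ε) (i : Fin d) : tubeScale d ε i ≠ 0 := by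
  unfold tubeScale
  split_ifs
  · exact hε.ne'
  · exact (Real.sqrt_pos.mpr hε).ne'

theorem tubeScale_sq_le {ε : ℝ} (hε : 0 < ε) (hε1 : ε ≤ 1) (i : Fin d) :
    tubeScale d ε i ^ 2 ≤ ε := by
  unfold tubeScale
  split_ifs
  · nlinarith
  · rw [Real.sq_sqrt hε.le]

/-- Transfers the support of the profile `Φ` to the wave packet. -/
theorem mem_tube_of_norm_lt_one {ε : ℝ} (hε : 0 < ε) {x : EuclideanSpace ℝ (Fin d)}
    (hx : ‖diagonalEquiv (tubeScale d ε) (tubeScale_ne_zero hε) x‖ < 1) : x ∈ tube d ε := by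
  set y := diagonalEquiv (tubeScale d ε) (tubeScale_ne_zero hε) x with hy
  have hyi : ∀ i, y i = tubeScale d ε i * x i := fun i => rfl
  have hnorm : ∑ i, y i ^ 2 < 1 := by
    have h1 := EuclideanSpace.norm_sq_eq y
    simp only [Real.norm_eq_abs, sq_abs] at h1
    rw [← h1]
    exact pow_lt_one₀ (norm_nonneg _) hx two_ne_zero
  refine ⟨fun i hi => ?_, ?_⟩
  · have h1 : y i ^ 2 < 1 :=
      (Finset.single_le_sum (f := fun i => y i ^ 2) (fun _ _ => sq_nonneg _)
        (Finset.mem_univ i)).trans_lt hnorm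
    have h2 : |y i| < 1 := by rwa [sq_lt_one_iff_abs_lt_one] at h1
    rw [hyi, tubeScale, if_pos hi, abs_mul, abs_of_pos hε] at h2
    rw [← one_div, lt_div_iff₀ hε]
    linarith
  · have h1 : ε * ∑ i : Fin d with i.val ≠ 0, x i ^ 2 < 1 := by
      refine lt_of_le_of_lt ?_ hnorm
      rw [Finset.mul_sum]
      calc ∑ i : Fin d with i.val ≠ 0, ε * x i ^ 2
          = ∑ i : Fin d with i.val ≠ 0, y i ^ 2 := by
            refine Finset.sum_congr rfl fun i hi => ?_
            rw [hyi, tubeScale, if_neg (Finset.mem_filter.mp hi).2, mul_pow, Real.sq_sqrt hε.le]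
        _ ≤ ∑ i, y i ^ 2 := Finset.sum_le_sum_of_subset_of_nonneg (Finset.filter_subset _ _)
            fun _ _ _ => sq_nonneg _
    rw [Real.sqrt_eq_rpow, Real.rpow_neg hε.le, ← Real.inv_rpow hε.le]
    refine Real.rpow_lt_rpow (Finset.sum_nonneg fun _ _ => sq_nonneg _) ?_ (by norm_num)
    rw [← one_div, lt_div_iff₀ hε]
    linarith

/-- The tube potentials: bounded by a multiple of `ε` on the tube, and with eigenvalue `z_ε`. -/
theorem exists_tube_potentials (hd : 0 < d) :
    ∃ (V : ℝ → BoundedPotential d) (C : ℝ), 0 < C ∧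
      (∀ ε : ℝ, 0 < ε → (∀ᵐ x, x ∉ tube d ε → V ε x = 0) ∧
        IsEigenvalue (schrodingerOperator (V ε)) (zEps ε)) ∧
      ∀ ε : ℝ, 0 < ε → ε ≤ 1 →
        ∀ᵐ x, ‖V ε x‖ ≤ C * ε * (tube d ε).indicator (fun _ => (1 : ℝ)) x := by
  set j : Fin d := ⟨0, hd⟩ with hj
  let η : ContDiffBump (0 : EuclideanSpace ℝ (Fin d)) := ⟨1 / 4, 1 / 2, by norm_num, by norm_num⟩
  have hη₁ : HasCompactSupport (Complex.ofRealCLM ∘ η) := η.hasCompactSupport.comp_left rfl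
  have hη₂ : ContDiff ℝ ((⊤ : ℕ∞) : WithTop ℕ∞) (Complex.ofRealCLM ∘ η) :=
    Complex.ofRealCLM.contDiff.comp η.contDiff
  set Φ : 𝓢(EuclideanSpace ℝ (Fin d), ℂ) := hη₁.toSchwartzMap hη₂ with hΦ
  have hΦapply : ∀ x, Φ x = (η x : ℂ) := fun _ => rfl
  have hΦ0 : Φ 0 = 1 := by
    rw [hΦapply, η.one_of_mem_closedBall (by simp [η])]
    simp
  have hΦne : Φ ≠ 0 := by
    intro h
    rw [h] at hΦ0
    simp at hΦ0
  have hnorm : 0 < ‖Φ.toLp 2 volume‖ := by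
    rw [norm_pos_iff]
    intro h0
    refine hΦne (SchwartzMap.injective_toLp 2 volume (h0.trans ?_))
    exact (map_zero (SchwartzMap.toLpCLM ℂ (E := EuclideanSpace ℝ (Fin d)) ℂ 2 volume)).symm
  let e : Fin d → EuclideanSpace ℝ (Fin d) := fun i => EuclideanSpace.single i 1
  -- One summand for each error term in `helmholtz_wavePacket`, with the factor `ε` taken out.
  obtain ⟨B, hBdef⟩ : ∃ B : ℝ, B = ∑ i, ‖(∂_{e i} (∂_{e i} Φ)).toLp 2 volume‖
    + 2 * ‖(∂_{e j} Φ).toLp 2 volume‖ + ‖Φ.toLp 2 volume‖ := ⟨_, rfl⟩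
  have hB : 0 < B := by
    rw [hBdef]
    exact add_pos_of_nonneg_of_pos (add_nonneg (Finset.sum_nonneg fun _ _ => norm_nonneg _)
      (mul_nonneg zero_le_two (norm_nonneg _))) hnorm
  -- Positivity sits inside the existential so that `choose` yields a function on all of `ℝ`; the
  -- value for `ε ≤ 0` is irrelevant.
  have hexists : ∀ ε : ℝ, ∃ V : BoundedPotential d, 0 < ε →
      ((∀ᵐ x, x ∉ tube d ε → V x = 0) ∧ IsEigenvalue (schrodingerOperator V) (zEps ε)) ∧
      (ε ≤ 1 → ∀ᵐ x, ‖V x‖ ≤ B / ‖Φ.toLp 2 volume‖ * ε *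
        (tube d ε).indicator (fun _ => (1 : ℝ)) x) := by
    intro ε
    by_cases hε : 0 < ε
    swap
    · exact ⟨0, fun h => absurd h hε⟩
    have ha := tubeScale_ne_zero (d := d) hε
    set φ := wavePacket j (tubeScale d ε) ha Φ with hφ
    obtain ⟨κ, hκ, hκnorm⟩ := exists_norm_wavePacket_eq j (tubeScale d ε) ha
    have hφpos : 0 < ‖φ.toLp 2 volume‖ := by
      rw [hφ, hκnorm]
      positivity
    have hφne : φ ≠ 0 := by
      intro h0
      rw [h0] at hφpos
      have h1 := map_zero (SchwartzMap.toLpCLM ℂ (E := EuclideanSpace ℝ (Fin d)) ℂ 2 volume)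
      rw [SchwartzMap.toLpCLM_apply] at h1
      rw [h1, norm_zero] at hφpos
      exact lt_irrefl _ hφpos
    have hsupp : tsupport φ ⊆ tube d ε := by
      have hclosed : IsClosed {x : EuclideanSpace ℝ (Fin d) |
          ‖diagonalEquiv (tubeScale d ε) ha x‖ ≤ 1 / 2} :=
        isClosed_le (by fun_prop) continuous_const
      refine (closure_minimal (fun x hx => ?_) hclosed).trans fun x hx =>
        mem_tube_of_norm_lt_one hε (lt_of_le_of_lt hx (by norm_num))
      by_contra hlt
      refine hx ?_
      rw [hφ, wavePacket_apply, hΦapply, η.zero_of_le_dist, Complex.ofReal_zero, mul_zero]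
      rw [dist_zero_right]
      exact (not_le.mp hlt).le
    have hmeas := measurableSet_tube d ε
    have hfin : volume (tube d ε) ≠ ∞ :=
      ne_top_of_le_ne_top ENNReal.ofReal_ne_top (volume_tube_le hd hε)
    have hz : (zEps ε).im ≠ 0 := by rw [zEps_im]; exact hε.ne'
    -- Taking `c` to be the exact relative error gives the eigenvalue for every `ε > 0`; only the
    -- estimate `c ≤ C ε` requires `ε ≤ 1`.
    obtain ⟨V, hV, heig⟩ := exists_potential_of_approximate_eigenfunction hz hmeas hfin hφne hsupp
      (c := ‖(-Δ φ - zEps ε • φ).toLp 2 volume‖ / ‖φ.toLp 2 volume‖)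
      (div_mul_cancel₀ _ hφpos.ne').ge
    refine ⟨V, fun _ => ⟨⟨?_, heig⟩, fun hε1 => ?_⟩⟩
    · filter_upwards [hV] with x hx hxt
      rw [Set.indicator_of_notMem hxt, mul_zero] at hx
      exact norm_le_zero_iff.mp hx
    · have hc : ‖(-Δ φ - zEps ε • φ).toLp 2 volume‖ / ‖φ.toLp 2 volume‖
          ≤ B / ‖Φ.toLp 2 volume‖ * ε := by
        rw [zEps, hφ, helmholtz_wavePacket, hκnorm, hκnorm, mul_div_mul_left _ _ hκ.ne',
          div_mul_eq_mul_div]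
        refine div_le_div_of_nonneg_right ?_ hnorm.le
        simp only [← SchwartzMap.toLpCLM_apply (𝕜 := ℂ), map_sub, map_neg, map_sum, map_smul]
        have hscale : tubeScale d ε j = ε := by simp [tubeScale, hj]
        refine (norm_sub_le _ _).trans ((add_le_add_left (norm_sub_le _ _) _).trans ?_)
        rw [norm_neg]
        have e1 : ‖∑ i, ((tubeScale d ε i : ℂ) ^ 2) •
            SchwartzMap.toLpCLM ℂ ℂ 2 volume (∂_{e i} (∂_{e i} Φ))‖
            ≤ ∑ i, ε * ‖(∂_{e i} (∂_{e i} Φ)).toLp 2 volume‖ := by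
          refine norm_sum_le_of_le _ fun i _ => ?_
          rw [norm_smul, norm_pow, Complex.norm_real, Real.norm_eq_abs, sq_abs]
          exact mul_le_mul_of_nonneg_right (tubeScale_sq_le hε hε1 i) (norm_nonneg _)
        have e2 : ‖(2 * Complex.I * (tubeScale d ε j : ℂ)) •
            SchwartzMap.toLpCLM ℂ ℂ 2 volume (∂_{e j} Φ)‖
            = 2 * ε * ‖(∂_{e j} Φ).toLp 2 volume‖ := by
          rw [norm_smul, hscale]
          simp [abs_of_pos hε]
        have e3 : ‖(Complex.I * (ε : ℂ)) • SchwartzMap.toLpCLM ℂ ℂ 2 volume Φ‖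
            = ε * ‖Φ.toLp 2 volume‖ := by
          rw [norm_smul]
          simp [abs_of_pos hε]
        refine (add_le_add (add_le_add e1 e2.le) e3.le).trans (le_of_eq ?_)
        rw [← Finset.mul_sum, hBdef]
        ring
      filter_upwards [hV] with x hx
      refine hx.trans (mul_le_mul_of_nonneg_right hc ?_)
      exact Set.indicator_nonneg (fun _ _ => zero_le_one) x
  choose V hV using hexists
  exact ⟨V, B / ‖Φ.toLp 2 volume‖, by positivity, fun ε hε => (hV ε hε).1,
    fun ε hε => (hV ε hε).2⟩

/-! ### The sharpness of the eigenvalue bound -/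

theorem norm_le_norm_indicator_of_le_mul {s : Set (EuclideanSpace ℝ (Fin d))}
    {V : BoundedPotential d} {M : ℝ} (hM : 0 ≤ M)
    (hV : ∀ᵐ x, ‖V x‖ ≤ M * s.indicator (fun _ => (1 : ℝ)) x) :
    ∀ᵐ x, ‖V x‖ ≤ ‖s.indicator (fun _ => M) x‖ := by
  filter_upwards [hV] with x hx
  refine hx.trans (le_of_eq ?_)
  by_cases hxs : x ∈ s
  · simp [Set.indicator_of_mem hxs, abs_of_nonneg hM]
  · simp [Set.indicator_of_notMem hxs]

theorem memLp_of_norm_le_indicator {s : Set (EuclideanSpace ℝ (Fin d))} (hs : MeasurableSet s)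
    (hμs : volume s ≠ ∞) {V : BoundedPotential d} {M : ℝ} (hM : 0 ≤ M)
    (hV : ∀ᵐ x, ‖V x‖ ≤ M * s.indicator (fun _ => (1 : ℝ)) x) (p : ℝ≥0∞) :
    MemLp V p volume :=
  (memLp_indicator_const p hs M (Or.inr hμs)).of_le (Lp.aestronglyMeasurable V)
    (norm_le_norm_indicator_of_le_mul hM hV)

theorem potentialNormPow_le {s : Set (EuclideanSpace ℝ (Fin d))} (hs : MeasurableSet s)
    {V : BoundedPotential d} {M : ℝ} (hM : 0 ≤ M)
    (hV : ∀ᵐ x, ‖V x‖ ≤ M * s.indicator (fun _ => (1 : ℝ)) x) {q : ℝ} (hq : 0 < q) :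
    potentialNormPow q V ≤ ENNReal.ofReal (M ^ q) * volume s := by
  have hq0 : ENNReal.ofReal q ≠ 0 := by simpa using hq
  have h1 := eLpNorm_mono_ae (p := ENNReal.ofReal q) (norm_le_norm_indicator_of_le_mul hM hV)
  rw [eLpNorm_indicator_const hs hq0 ENNReal.ofReal_ne_top, ENNReal.toReal_ofReal hq.le] at h1
  refine (ENNReal.rpow_le_rpow h1 hq.le).trans (le_of_eq ?_)
  rw [ENNReal.mul_rpow_of_nonneg _ _ hq.le, ← ENNReal.rpow_mul, one_div_mul_cancel hq.ne',
    ENNReal.rpow_one, Real.enorm_of_nonneg hM, ENNReal.ofReal_rpow_of_nonneg hM hq.le]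

/-- Height to the power `q` times volume: `ε^q · ε^(-(d+1)/2)` is exactly the critical power of the
distance `ε`. -/
theorem potentialNormPow_le_of_tube (hd : 0 < d) {ε C q : ℝ} (hε : 0 < ε) (hC : 0 < C)
    (hq : 0 < q) {V : BoundedPotential d}
    (hV : ∀ᵐ x, ‖V x‖ ≤ C * ε * (tube d ε).indicator (fun _ => (1 : ℝ)) x) :
    potentialNormPow q V ≤
      ENNReal.ofReal (C ^ q * 2 ^ d * ε ^ (q - ((d : ℝ) + 1) / 2)) := by
  refine (potentialNormPow_le (measurableSet_tube d ε) (by positivity) hV hq).trans ?_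
  refine (mul_le_mul_right (volume_tube_le hd hε) _).trans (le_of_eq ?_)
  rw [← ENNReal.ofReal_mul (by positivity)]
  congr 1
  rw [Real.mul_rpow hC.le hε.le, sub_eq_add_neg, Real.rpow_add hε]
  ring

end

theorem theorem2 (d : ℕ) (hd : 2 ≤ d) :
    -- one family of potentials `V_ε`, depending only on `d`
    ∃ V : ℝ → BoundedPotential d,
      -- `V_ε` is supported in the tube and `z_ε = 1 + iε` is an eigenvalue of `-Δ + V_ε`
      (∀ ε : ℝ, 0 < ε →
        (∀ᵐ x : EuclideanSpace ℝ (Fin d), x ∉ tube d ε → V ε x = 0) ∧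
        IsEigenvalue (schrodingerOperator (V ε)) (zEps ε)) ∧
      -- `|V_ε| ≤ C ε χ_ε` for small `ε`
      (∃ C : ℝ, ∃ ε₀ : ℝ, 0 < ε₀ ∧ ∀ ε : ℝ, 0 < ε → ε < ε₀ →
        ∀ᵐ x : EuclideanSpace ℝ (Fin d),
          ‖V ε x‖ ≤ C * ε * (tube d ε).indicator (fun _ => (1 : ℝ)) x) ∧
      ∀ q : ℝ, ((d : ℝ) + 1) / 2 ≤ q →
        -- the lower bound for the quotient
        0 < liminf (fun ε : ℝ =>
            ENNReal.ofReal (Metric.infDist (zEps ε) nonnegRealAxis ^ (q - ((d : ℝ) + 1) / 2) *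
              ‖zEps ε‖ ^ ((1 : ℝ) / 2)) / potentialNormPow q (V ε)) (𝓝[>] (0 : ℝ)) ∧
        -- hence the exponent of `dist(z, ℝ₊)` in the scale-invariant bound cannot be lowered
        ∀ α : ℝ, α < q - ((d : ℝ) + 1) / 2 →
          ∀ C : ℝ≥0, ¬ EigenvalueBound d q α (q - (d : ℝ) / 2 - α) C := by
  have hd0 : 0 < d := by omega
  obtain ⟨V, C, hC, hV, hbound⟩ := exists_tube_potentials hd0
  refine ⟨V, hV, ⟨C, 1, one_pos, fun ε hε hε1 => hbound ε hε hε1.le⟩, fun q hq => ?_⟩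
  have hq0 : 0 < q := lt_of_lt_of_le (by positivity) hq
  set K : ℝ := C ^ q * 2 ^ d with hK
  have hKpos : 0 < K := by positivity
  have hsmall : ∀ᶠ ε : ℝ in 𝓝[>] (0 : ℝ), 0 < ε ∧ ε ≤ 1 := by
    filter_upwards [Ioc_mem_nhdsGT (zero_lt_one' ℝ)] with ε hε using hε
  have hnormV : ∀ ε : ℝ, 0 < ε → ε ≤ 1 →
      potentialNormPow q (V ε) ≤ ENNReal.ofReal (K * ε ^ (q - ((d : ℝ) + 1) / 2)) :=
    fun ε hε hε1 => potentialNormPow_le_of_tube hd0 hε hC hq0 (hbound ε hε hε1)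
  constructor
  · refine lt_of_lt_of_le (ENNReal.ofReal_pos.mpr (inv_pos.mpr hKpos))
      (le_liminf_of_le (by isBoundedDefault) ?_)
    filter_upwards [hsmall] with ε hε
    rw [infDist_zEps hε.1]
    have hpow : 0 < ε ^ (q - ((d : ℝ) + 1) / 2) := Real.rpow_pos_of_pos hε.1 _
    have h1 : K⁻¹ = ε ^ (q - ((d : ℝ) + 1) / 2) / (K * ε ^ (q - ((d : ℝ) + 1) / 2)) :=
      (div_mul_cancel_right₀ hpow.ne' K).symm
    rw [h1, ENNReal.ofReal_div_of_pos (by positivity)]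
    refine ENNReal.div_le_div (ENNReal.ofReal_le_ofReal ?_) (hnormV ε hε.1 hε.2)
    exact le_mul_of_one_le_right hpow.le
      (Real.one_le_rpow (one_le_norm_zEps ε) (by norm_num))
  · intro α hα C' hbd
    -- The assumed bound, divided by `ε^α`. The left side tends to 1, while the right side tends to
    -- 0 because `α` is below the critical exponent.
    have hineq : ∀ᶠ ε : ℝ in 𝓝[>] (0 : ℝ), ‖zEps ε‖ ^ (q - (d : ℝ) / 2 - α) ≤
        C' * K * ε ^ (q - ((d : ℝ) + 1) / 2 - α) := by
      filter_upwards [hsmall] with ε hε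
      have hfin : volume (tube d ε) ≠ ∞ :=
        ne_top_of_le_ne_top ENNReal.ofReal_ne_top (volume_tube_le hd0 hε.1)
      have hε0 := hε.1
      have h1 := hbd (V ε) (memLp_of_norm_le_indicator (measurableSet_tube d ε) hfin
        (by positivity) (hbound ε hε.1 hε.2) _) (zEps ε) (zEps_notMem_nonnegRealAxis hε.1)
        (hV ε hε.1).2
      rw [infDist_zEps hε.1] at h1
      have h2 := h1.trans (mul_le_mul_right (hnormV ε hε.1 hε.2) _)
      rw [← ENNReal.ofReal_coe_nnreal, ← ENNReal.ofReal_mul C'.coe_nonneg,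
        ENNReal.ofReal_le_ofReal_iff (by positivity)] at h2
      have hα0 : 0 < ε ^ α := Real.rpow_pos_of_pos hε.1 _
      rw [Real.rpow_sub hε.1 _ α, ← mul_div_assoc, le_div_iff₀ hα0]
      linarith
    have hleft : Tendsto (fun ε : ℝ => ‖zEps ε‖ ^ (q - (d : ℝ) / 2 - α)) (𝓝[>] (0 : ℝ))
        (𝓝 1) := by
      have hz : Tendsto (fun ε : ℝ => ‖zEps ε‖) (𝓝 0) (𝓝 ‖zEps 0‖) := by
        have hc : Continuous fun ε : ℝ => ‖zEps ε‖ := by unfold zEps; fun_prop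
        exact hc.tendsto 0
      have h0 : ‖zEps 0‖ = 1 := by simp [zEps]
      rw [h0] at hz
      have h1 := hz.rpow_const (p := q - (d : ℝ) / 2 - α) (Or.inl one_ne_zero)
      rw [Real.one_rpow] at h1
      exact h1.mono_left nhdsWithin_le_nhds
    have hright : Tendsto (fun ε : ℝ => C' * K * ε ^ (q - ((d : ℝ) + 1) / 2 - α))
        (𝓝[>] (0 : ℝ)) (𝓝 0) := by
      have hpos : 0 < q - ((d : ℝ) + 1) / 2 - α := by linarith
      have h1 : Tendsto (fun ε : ℝ => ε ^ (q - ((d : ℝ) + 1) / 2 - α)) (𝓝 0) (𝓝 0) := by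
        have h2 := (Real.continuousAt_rpow_const 0 _ (Or.inr hpos.le)).tendsto
        rwa [Real.zero_rpow hpos.ne'] at h2
      have h3 := (h1.mono_left (nhdsWithin_le_nhds (s := Set.Ioi 0))).const_mul (C' * K)
      rwa [mul_zero] at h3
    exact absurd (le_of_tendsto_of_tendsto hleft hright hineq) (by norm_num)
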